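/- For an integer $k\ge 1$ let $$P_k(x)=\prod_{0\le i,j\le k-1}\Bigl(1+\frac{x}{i+j+1}\Bigr)=\sum_{r=0}^{k^2}c_r(k)\,x^{k^2-r}$$ be the moment polynomial of the characteristic polynomials of random unitary matrices. For every integer $r$ with $0<r<k^2$ there is a unique positive number $u=u_{r,k}$ with $$u\sum_{j=1}^k\frac{j}{u+j}+u\sum_{j=k+1}^{2k}\frac{2k-j}{u+j}=k^2-r .$$ Put $$U=U_{r,k}=u\sum_{j=1}^k\frac{j^2}{(u+j)^2}+u\sum_{j=k+1}^{2k}\frac{j(2k-j)}{(u+j)^2}.$$ Then, uniformly in the integers $0<r<k^2$, as $k\to\infty$, $$c_r(k)=\Bigl(\frac{r}{k^2}\Bigr)^r\binom{k^2}{r}\frac{P_k(u)}{\sqrt U\,u^{k^2-r}}\Bigl(1-\frac{r}{k^2}\Bigr)^{k^2-r+1/2}r^{1/2}\Bigl[1+O\Bigl(\frac{\log k}{k^{2/3}}\Bigr)\Bigr].$$ Moreover, for every fixed real $\alpha<1$, uniformly in the integers $0\le r\le k^\alpha$, as $k\to\infty$, $$\frac{c_r(k)}{c_0(k)}=\frac{k^{3r}}{r!}\bigl[1+O(k^{2(\alpha-1)})\bigr]=\binom{k^2}{r}k^r\bigl[1+O(k^{2(\alpha-1)})\bigr]$$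 and $$c_{k^2-r}(k)=\frac{(kA)^r}{r!}\bigl[1+O(k^{2(\alpha-1)}\log k)\bigr]=\binom{k^2}{r}\frac{A^r}{k^r}\bigl[1+O(k^{2(\alpha-1)}\log k)\bigr],$$ with implied constants depending on $\alpha$ only, where $$A=2\sum_{j=k+1}^{2k}\frac1j=\log 4-\frac1{2k}+O\Bigl(\frac1{k^2}\Bigr).$$ -/

import Mathlib

/-- The moment polynomial `P_k(x) = ∏_{0 ≤ i, j ≤ k-1} (1 + x / (i + j + 1))`. -/
noncomputable def momentPoly (k : ℕ) : Polynomial ℝ :=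
  ∏ i ∈ Finset.range k, ∏ j ∈ Finset.range k,
    (1 + Polynomial.C (1 / ((i : ℝ) + (j : ℝ) + 1)) * Polynomial.X)

/-- The coefficient `c_r(k)` in `P_k(x) = ∑_{r=0}^{k²} c_r(k) x^{k² - r}`
(meaningful for `0 ≤ r ≤ k²`). -/
noncomputable def momentCoeff (k r : ℕ) : ℝ :=
  (momentPoly k).coeff (k ^ 2 - r)

/-- The left-hand side of the saddle-point equation,
`u ∑_{j=1}^k j / (u + j) + u ∑_{j=k+1}^{2k} (2k - j) / (u + j)`. -/
noncomputable def saddleLHS (k : ℕ) (u : ℝ) : ℝ :=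
  u * ∑ j ∈ Finset.Icc 1 k, (j : ℝ) / (u + j) +
    u * ∑ j ∈ Finset.Icc (k + 1) (2 * k), (2 * (k : ℝ) - j) / (u + j)

/-- `u = u_{r,k}` is a positive solution of the saddle-point equation. -/
def IsSaddle (k r : ℕ) (u : ℝ) : Prop :=
  0 < u ∧ saddleLHS k u = (k : ℝ) ^ 2 - r

/-- `U = u ∑_{j=1}^k j² / (u + j)² + u ∑_{j=k+1}^{2k} j (2k - j) / (u + j)²`. -/
noncomputable def saddleU (k : ℕ) (u : ℝ) : ℝ :=
  u * ∑ j ∈ Finset.Icc 1 k, (j : ℝ) ^ 2 / (u + j) ^ 2 +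
    u * ∑ j ∈ Finset.Icc (k + 1) (2 * k), (j : ℝ) * (2 * (k : ℝ) - j) / (u + j) ^ 2

/-- `A = 2 ∑_{j=k+1}^{2k} 1 / j`. -/
noncomputable def harmonicA (k : ℕ) : ℝ :=
  2 * ∑ j ∈ Finset.Icc (k + 1) (2 * k), 1 / (j : ℝ)

/-- The main term of the uniform asymptotic formula,
`(r/k²)^r * binom(k², r) * P_k(u) / (√U u^(k²-r)) * (1 - r/k²)^(k²-r+1/2) * r^(1/2)`,
for `0 < r < k²`. -/
noncomputable def uniformMain (k r : ℕ) (u : ℝ) : ℝ :=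
  ((r : ℝ) / (k : ℝ) ^ 2) ^ r * ((k ^ 2).choose r : ℝ) *
    ((momentPoly k).eval u / (Real.sqrt (saddleU k u) * u ^ (k ^ 2 - r))) *
    (1 - (r : ℝ) / (k : ℝ) ^ 2) ^ ((k : ℝ) ^ 2 - (r : ℝ) + 1 / 2) *
    (r : ℝ) ^ (1 / 2 : ℝ)

/-- `P_k` has degree at most `k²`. -/
theorem momentPoly_natDegree_le (k : ℕ) : (momentPoly k).natDegree ≤ k ^ 2 := by
  unfold momentPoly
  refine (Polynomial.natDegree_prod_le _ _).trans ?_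
  refine (Finset.sum_le_sum (g := fun _ => k) fun i _ => ?_).trans (by simp [sq])
  refine (Polynomial.natDegree_prod_le _ _).trans ?_
  refine (Finset.sum_le_sum (g := fun _ => 1) fun j _ => ?_).trans (by simp)
  compute_degree

/-- The defining expansion `P_k(x) = ∑_{r=0}^{k²} c_r(k) x^{k² - r}`. -/
theorem momentPoly_eval_eq_sum (k : ℕ) (x : ℝ) :
    (momentPoly k).eval x =
      ∑ r ∈ Finset.range (k ^ 2 + 1), momentCoeff k r * x ^ (k ^ 2 - r) := by
  rw [Polynomial.eval_eq_sum_range' (Nat.lt_succ_of_le (momentPoly_natDegree_le k)),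
    ← Finset.sum_range_reflect]
  simp [momentCoeff]

/-- At a natural number `N`, `P_k(N)` is the `2k`-th moment
`∏_{n=1}^N Γ(n) Γ(n + 2k) / Γ(n + k)²` of the characteristic polynomial over `U(N)`. -/
theorem momentPoly_eval_natCast (k N : ℕ) :
    (momentPoly k).eval (N : ℝ) =
      ∏ n ∈ Finset.Icc 1 N,
        Real.Gamma n * Real.Gamma ((n : ℝ) + 2 * k) / Real.Gamma ((n : ℝ) + k) ^ 2 := by
  have key : ∀ (f : ℕ → ℝ) (m : ℕ), (∀ i, f i ≠ 0) →
      ∏ i ∈ Finset.range m, f (i + 1) / f i = f m / f 0 := by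
    intro f m hf
    induction m with
    | zero => simp [hf 0]
    | succ m ih =>
      rw [Finset.prod_range_succ, ih]
      field_simp [hf m, hf 0]
  have hG : ∀ (x : ℝ) (m : ℕ), 0 < x →
      ∏ i ∈ Finset.range m, (x + i) = Real.Gamma (x + m) / Real.Gamma x := by
    intro x m hx
    have h := key (fun i => Real.Gamma (x + i)) m
      (fun i => (Real.Gamma_pos_of_pos (by positivity)).ne')
    simp only [Nat.cast_zero, add_zero] at h
    rw [← h]
    refine Finset.prod_congr rfl fun i _ => ?_
    have hi : (0 : ℝ) < x + i := by positivity
    rw [Nat.cast_add, Nat.cast_one, ← add_assoc, Real.Gamma_add_one hi.ne',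
      mul_div_cancel_right₀ _ (Real.Gamma_pos_of_pos hi).ne']
  induction N with
  | zero => simp [momentPoly, Polynomial.eval_prod]
  | succ N ih =>
    rw [Finset.prod_Icc_succ_top (by omega), ← ih]
    have hstep : (momentPoly k).eval ((N + 1 : ℕ) : ℝ) = (momentPoly k).eval (N : ℝ) *
        ∏ i ∈ Finset.range k, ∏ j ∈ Finset.range k,
          (((N : ℝ) + i + 1) + ((j + 1 : ℕ) : ℝ)) / (((N : ℝ) + i + 1) + (j : ℝ)) := by
      simp only [momentPoly, Polynomial.eval_prod, ← Finset.prod_mul_distrib]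
      refine Finset.prod_congr rfl fun i _ => Finset.prod_congr rfl fun j _ => ?_
      have h1 : (i : ℝ) + j + 1 ≠ 0 := by positivity
      have h2 : (N : ℝ) + i + 1 + j ≠ 0 := by positivity
      simp only [Polynomial.eval_add, Polynomial.eval_one, Polynomial.eval_mul,
        Polynomial.eval_C, Polynomial.eval_X]
      push_cast
      field_simp
      ring
    rw [hstep]
    congr 1
    have h3 : ∀ i ∈ Finset.range k, ∏ j ∈ Finset.range k,
          (((N : ℝ) + i + 1) + ((j + 1 : ℕ) : ℝ)) / (((N : ℝ) + i + 1) + (j : ℝ)) =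
        (((N : ℝ) + k + 1) + i) / (((N : ℝ) + 1) + i) := by
      intro i _
      rw [key (fun j => ((N : ℝ) + i + 1) + (j : ℝ)) k (fun j => by positivity)]
      simp only [Nat.cast_zero, add_zero]
      congr 1 <;> ring
    rw [Finset.prod_congr rfl h3, Finset.prod_div_distrib, hG _ _ (by positivity),
      hG _ _ (by positivity)]
    have e1 : (N : ℝ) + k + 1 + k = ((N + 1 : ℕ) : ℝ) + 2 * k := by push_cast; ring
    have e2 : (N : ℝ) + k + 1 = ((N + 1 : ℕ) : ℝ) + k := by push_cast; ring
    have e3 : (N : ℝ) + 1 + k = ((N + 1 : ℕ) : ℝ) + k := by push_cast; ring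
    have e4 : (N : ℝ) + 1 = ((N + 1 : ℕ) : ℝ) := by push_cast; ring
    rw [e1, e2, e3, e4]
    have g1 : Real.Gamma (((N + 1 : ℕ) : ℝ) + k) ≠ 0 :=
      (Real.Gamma_pos_of_pos (by positivity)).ne'
    have g2 : Real.Gamma ((N + 1 : ℕ) : ℝ) ≠ 0 :=
      (Real.Gamma_pos_of_pos (by positivity)).ne'
    field_simp

/-! Put s = k² - r and let X be a sum of k² independent Bernoulli variables with odds u/(i+j+1), 0 ≤
i, j < k. Then c_r(k) u^s / P_k(u) is P(X = s), the saddle equation says that X has mean s, and U is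
its variance. The remaining factors of the main term are exactly P(Y = s) √Var(Y) for Y binomial
with k² trials and mean s. So the uniform formula compares `normalizedCoeff` for two Bernoulli sums
with the same number of terms and the same integral mean (`normalizedCoeff_saddle`,
`uniformMain_eq`).

Both values are close to a common one. When the variance V is large, each is 1/√(2π) + O(1/V) by a
local limit theorem (`abs_normalizedCoeff_sub_le`), and `min_le_saddleU` gives V ≥ min(r, s)/36 at
the saddle. When s is small, each is the Poisson value `poissonPeak s` up to a relative error O(∑
b²), b being the odds; by `sum_sq_mul_le_of_mean` this is O(s² log k / k²). When r is small,
inverting the odds exchanges successes and failures and the error is O(r²/k²). Cutting at κ =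
k^(2/3) balances 1/κ against κ²/k²; the logarithm comes from ∑ (i+j+1)⁻².

The extreme coefficients are elementary symmetric functions e_r of the numbers i+j+1 (after division
by c_0) or of their inverses. With S the sum of the variables and T the sum of their squares, r! e_r
lies between S^r - (r(r-1)/2) T S^(r-2) and S^r. Here S = k³, T ≤ 2k⁴ in the first case, and S = kA,
T = O(log k) in the second. -/

/-- The generating polynomial `∏_{i ∈ s} (1 + b_i X)` of the elementary symmetric functions
of the family `b`. -/
noncomputable def linProd {ι : Type*} (s : Finset ι) (b : ι → ℝ) : Polynomial ℝ :=
  ∏ i ∈ s, (1 + Polynomial.C (b i) * Polynomial.X)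

/-! ### Elementary symmetric functions and their reversal -/

section LinProd

variable {ι : Type*}

theorem linProd_insert [DecidableEq ι] {s : Finset ι} {i : ι} (hi : i ∉ s) (b : ι → ℝ) :
    linProd (insert i s) b = (1 + Polynomial.C (b i) * Polynomial.X) * linProd s b := by
  rw [linProd, Finset.prod_insert hi, linProd]

theorem linProd_insert_coeff_succ [DecidableEq ι] {s : Finset ι} {i : ι} (hi : i ∉ s)
    (b : ι → ℝ) (r : ℕ) :
    (linProd (insert i s) b).coeff (r + 1) =
      (linProd s b).coeff (r + 1) + b i * (linProd s b).coeff r := by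
  rw [linProd_insert hi, add_mul, one_mul, Polynomial.coeff_add, mul_assoc,
    Polynomial.coeff_C_mul, Polynomial.coeff_X_mul]

theorem linProd_coeff_zero (s : Finset ι) (b : ι → ℝ) : (linProd s b).coeff 0 = 1 := by
  simp [linProd, Polynomial.coeff_zero_eq_eval_zero, Polynomial.eval_prod]

theorem linProd_eval (s : Finset ι) (b : ι → ℝ) (x : ℝ) :
    (linProd s b).eval x = ∏ i ∈ s, (1 + b i * x) := by
  simp [linProd, Polynomial.eval_prod]

theorem linProd_natDegree_le (s : Finset ι) (b : ι → ℝ) : (linProd s b).natDegree ≤ s.card := by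
  refine (Polynomial.natDegree_prod_le _ _).trans ?_
  refine (Finset.sum_le_sum (g := fun _ => 1) fun j _ => ?_).trans (by simp)
  compute_degree

theorem linProd_coeff_nonneg (s : Finset ι) (b : ι → ℝ) (hb : ∀ i ∈ s, 0 ≤ b i) (r : ℕ) :
    0 ≤ (linProd s b).coeff r := by
  classical
  induction s using Finset.induction_on generalizing r with
  | empty => simp only [linProd, Finset.prod_empty, Polynomial.coeff_one]; split_ifs <;> norm_num
  | insert i s hi ih =>
    have ih := ih fun j hj => hb j (Finset.mem_insert_of_mem hj)
    cases r with
    | zero => simp [linProd_coeff_zero]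
    | succ r =>
      rw [linProd_insert_coeff_succ hi]
      have := mul_nonneg (hb i (Finset.mem_insert_self _ _)) (ih r)
      linarith [ih (r + 1)]

theorem pow_succ_add_mul_le_add_pow {x y : ℝ} (hx : 0 ≤ x) (hy : 0 ≤ y) (n : ℕ) :
    x ^ (n + 1) + (n + 1) * y * x ^ n ≤ (x + y) ^ (n + 1) := by
  induction n with
  | zero => simp
  | succ n ih =>
    have := mul_le_mul_of_nonneg_right ih (add_nonneg hx hy)
    have h2 : 0 ≤ (n + 1 : ℝ) * y ^ 2 * x ^ n := by positivity
    rw [pow_succ (x + y)]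
    refine le_trans ?_ this
    push_cast
    ring_nf at h2 ⊢
    linarith

/-- Taylor's formula with the second-order remainder bounded at the right endpoint; it drives the
induction for the lower bound on r! e_r. -/
theorem add_pow_le_taylor_two {x y : ℝ} (hx : 0 ≤ x) (hy : 0 ≤ y) (n : ℕ) :
    (x + y) ^ (n + 2) ≤ x ^ (n + 2) + (n + 2) * y * x ^ (n + 1) +
      (n + 2) * (n + 1) / 2 * y ^ 2 * (x + y) ^ n := by
  induction n with
  | zero => simp; ring_nf; rfl
  | succ n ih =>
    have h1 := mul_le_mul_of_nonneg_right ih (add_nonneg hx hy)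
    have h2 : x ^ (n + 1) ≤ (x + y) ^ (n + 1) := pow_le_pow_left₀ hx (by linarith) _
    have h3 : 0 ≤ (n + 2 : ℝ) * y ^ 2 := by positivity
    have h4 := mul_le_mul_of_nonneg_left h2 h3
    calc (x + y) ^ (n + 1 + 2) = (x + y) ^ (n + 2) * (x + y) := by ring
      _ ≤ _ := h1
      _ = x ^ (n + 3) + (n + 3) * y * x ^ (n + 2) + (n + 2) * y ^ 2 * x ^ (n + 1) +
          (n + 2) * (n + 1) / 2 * y ^ 2 * (x + y) ^ (n + 1) := by ring
      _ ≤ x ^ (n + 3) + (n + 3) * y * x ^ (n + 2) + (n + 2) * y ^ 2 * (x + y) ^ (n + 1) +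
          (n + 2) * (n + 1) / 2 * y ^ 2 * (x + y) ^ (n + 1) := by linarith
      _ = _ := by push_cast; ring

/-- Expanding (∑ b)^r over r-tuples of indices, the tuples with distinct entries contribute r! e_r
and all others are nonnegative. -/
theorem factorial_mul_linProd_coeff_le (s : Finset ι) (b : ι → ℝ) (hb : ∀ i ∈ s, 0 ≤ b i)
    (r : ℕ) : (r.factorial : ℝ) * (linProd s b).coeff r ≤ (∑ i ∈ s, b i) ^ r := by
  classical
  induction s using Finset.induction_on generalizing r with
  | empty => cases r <;> simp [linProd, Polynomial.coeff_one]
  | insert i s hi ih =>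
    have hs : ∀ j ∈ s, 0 ≤ b j := fun j hj => hb j (Finset.mem_insert_of_mem hj)
    have ih := ih hs
    have hi0 := hb i (Finset.mem_insert_self _ _)
    cases r with
    | zero => simp [linProd_coeff_zero]
    | succ r =>
      rw [linProd_insert_coeff_succ hi, Finset.sum_insert hi]
      have h1 := pow_succ_add_mul_le_add_pow (Finset.sum_nonneg hs) hi0 r
      have h2 := mul_le_mul_of_nonneg_left (ih r) (by positivity : 0 ≤ (r + 1 : ℝ) * b i)
      have h3 := ih (r + 1)
      rw [Nat.factorial_succ] at h3 ⊢
      push_cast at h3 ⊢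
      rw [add_comm (b i)]
      linarith

/-- A tuple with a repetition has equal entries at one of the r(r-1)/2 pairs of positions, and each
pair accounts for (∑ b²)(∑ b)^(r-2). For r < 2 the truncated exponent is harmless, since r(r-1) = 0.
-/
theorem le_factorial_mul_linProd_coeff (s : Finset ι) (b : ι → ℝ) (hb : ∀ i ∈ s, 0 ≤ b i)
    (r : ℕ) :
    (∑ i ∈ s, b i) ^ r - r * (r - 1) / 2 * (∑ i ∈ s, b i ^ 2) * (∑ i ∈ s, b i) ^ (r - 2) ≤
      (r.factorial : ℝ) * (linProd s b).coeff r := by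
  classical
  induction s using Finset.induction_on generalizing r with
  | empty => cases r <;> simp [linProd, Polynomial.coeff_one]
  | insert i s hi ih =>
    have hs : ∀ j ∈ s, 0 ≤ b j := fun j hj => hb j (Finset.mem_insert_of_mem hj)
    have ih := ih hs
    have hi0 := hb i (Finset.mem_insert_self _ _)
    have hS : 0 ≤ ∑ j ∈ s, b j := Finset.sum_nonneg hs
    have hS2 : 0 ≤ ∑ j ∈ s, b j ^ 2 := Finset.sum_nonneg fun j _ => sq_nonneg _
    rcases r with _ | _ | r
    · simp [linProd_coeff_zero]
    · have h0 := ih 1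
      rw [linProd_insert_coeff_succ hi, Finset.sum_insert hi]
      simp [linProd_coeff_zero] at h0 ⊢
      linarith
    · rw [linProd_insert_coeff_succ hi, Finset.sum_insert hi, Finset.sum_insert hi,
        add_comm (b i), add_comm (b i ^ 2)]
      set S := ∑ j ∈ s, b j
      set T := ∑ j ∈ s, b j ^ 2
      have h1 := add_pow_le_taylor_two hS hi0 r
      have h2 := mul_le_mul_of_nonneg_left (ih (r + 1)) (by positivity : 0 ≤ (r + 2 : ℝ) * b i)
      have h3 := ih (r + 2)
      have h4 : S ^ r + r * b i * S ^ (r - 1) ≤ (S + b i) ^ r := by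
        cases r with
        | zero => simp
        | succ r =>
          have := pow_succ_add_mul_le_add_pow hS hi0 r
          simpa using this
      have h5 := mul_le_mul_of_nonneg_left h4
        (by positivity : 0 ≤ (r + 2 : ℝ) * (r + 1) / 2 * T)
      have e1 : r + 1 - 2 = r - 1 := by omega
      have e2 : r + 2 - 2 = r := by omega
      rw [e1] at h2
      rw [e2] at h3
      rw [show r + 1 + 1 - 2 = r by omega]
      rw [Nat.factorial_succ] at h3 ⊢
      push_cast at h2 h3 ⊢
      ring_nf at h1 h2 h3 h5 ⊢
      linarith

/-- Choosing r factors is choosing the complementary ones to omit: 1 + bX = bX(1 + b⁻¹X⁻¹), so the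
coefficients are reversed. -/
theorem linProd_inv_coeff_sub (s : Finset ι) (b : ι → ℝ) (hb : ∀ i ∈ s, b i ≠ 0) {r : ℕ}
    (hr : r ≤ s.card) :
    (linProd s b).coeff r =
      (∏ i ∈ s, b i) * (linProd s fun i => (b i)⁻¹).coeff (s.card - r) := by
  classical
  induction s using Finset.induction_on generalizing r with
  | empty =>
    have : r = 0 := by simpa using hr
    simp [this, linProd]
  | insert i s hi ih =>
    have ih := fun r => @ih (fun j hj => hb j (Finset.mem_insert_of_mem hj)) r
    have hi0 := hb i (Finset.mem_insert_self _ _)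
    have hdeg : ∀ c : ι → ℝ, (linProd s c).coeff (s.card + 1) = 0 := fun c =>
      Polynomial.coeff_eq_zero_of_natDegree_lt
        (Nat.lt_succ_of_le (linProd_natDegree_le s c))
    rw [Finset.card_insert_of_notMem hi] at hr ⊢
    rw [Finset.prod_insert hi]
    rcases r with _ | r
    · have := ih 0 (Nat.zero_le _)
      rw [linProd_coeff_zero] at this ⊢
      rw [Nat.sub_zero, linProd_insert_coeff_succ hi, hdeg, zero_add]
      rw [Nat.sub_zero] at this
      rw [this]
      field_simp
    · rw [linProd_insert_coeff_succ hi, ih r (by omega)]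
      rcases Nat.lt_or_ge r s.card with h | h
      · rw [ih (r + 1) h, show s.card + 1 - (r + 1) = (s.card - (r + 1)) + 1 by omega,
          linProd_insert_coeff_succ hi, show s.card - (r + 1) + 1 = s.card - r by omega]
        field_simp
        ring
      · have : r = s.card := by omega
        subst this
        simp [hdeg, linProd_coeff_zero]

theorem linProd_const_mul (s : Finset ι) (b : ι → ℝ) (t : ℝ) (r : ℕ) :
    (linProd s fun i => b i * t).coeff r = (linProd s b).coeff r * t ^ r := by
  have : (linProd s fun i => b i * t) = (linProd s b).comp (Polynomial.C t * Polynomial.X) := by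
    simp only [linProd, Polynomial.prod_comp]
    refine Finset.prod_congr rfl fun i _ => ?_
    simp
    ring
  rw [this, Polynomial.comp_C_mul_X_coeff]

theorem linProd_const_coeff (s : Finset ι) (c : ℝ) (r : ℕ) :
    (linProd s fun _ => c).coeff r = (s.card.choose r : ℝ) * c ^ r := by
  have h := linProd_const_mul s (fun _ => 1) c r
  simp only [one_mul] at h
  rw [h]
  congr 1
  simp only [linProd, Finset.prod_const, Polynomial.C_1, one_mul]
  exact Polynomial.coeff_one_add_X_pow ℝ _ _

/-- `P(X = r) √(Var X)` for a sum `X` of independent Bernoulli variables with odds `b_i`. -/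
noncomputable def normalizedCoeff (s : Finset ι) (b : ι → ℝ) (r : ℕ) : ℝ :=
  (linProd s b).coeff r * √(∑ i ∈ s, b i / (1 + b i) ^ 2) / ∏ i ∈ s, (1 + b i)

/-- Counting failures instead of successes inverts the odds and leaves the variance unchanged. -/
theorem normalizedCoeff_inv (s : Finset ι) (b : ι → ℝ) (hb : ∀ i ∈ s, 0 < b i) {r : ℕ}
    (hr : r ≤ s.card) :
    normalizedCoeff s b r = normalizedCoeff s (fun i => (b i)⁻¹) (s.card - r) := by
  have h1 : ∑ i ∈ s, (b i)⁻¹ / (1 + (b i)⁻¹) ^ 2 = ∑ i ∈ s, b i / (1 + b i) ^ 2 := by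
    refine Finset.sum_congr rfl fun i hi => ?_
    have := hb i hi
    field_simp
    ring
  have h2 : ∏ i ∈ s, (1 + b i) = (∏ i ∈ s, b i) * ∏ i ∈ s, (1 + (b i)⁻¹) := by
    rw [← Finset.prod_mul_distrib]
    refine Finset.prod_congr rfl fun i hi => ?_
    have := hb i hi
    field_simp
    ring
  have h3 : ∏ i ∈ s, b i ≠ 0 := Finset.prod_ne_zero_iff.2 fun i hi => (hb i hi).ne'
  rw [normalizedCoeff, normalizedCoeff, h1, h2,
    linProd_inv_coeff_sub s b (fun i hi => (hb i hi).ne') hr, mul_assoc, mul_div_mul_left _ _ h3]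

end LinProd

/-! ### Poisson approximation when the squared odds have a small sum -/

section PoissonRegime

theorem exp_sub_sq_div_two_le {x : ℝ} (hx : 0 ≤ x) : Real.exp (x - x ^ 2 / 2) ≤ 1 + x := by
  have h1 := Real.le_log_one_add_of_nonneg hx
  have h2 : x - x ^ 2 / 2 ≤ 2 * x / (x + 2) := by
    rw [le_div_iff₀ (by linarith)]
    nlinarith [pow_nonneg hx 3]
  rw [← Real.le_log_iff_exp_le (by linarith)]
  exact h2.trans h1

/-- The function x^r e^(-x) is maximal at x = r; this replaces ∑ b by the mean r at no cost. -/
theorem pow_mul_exp_neg_le (r : ℕ) (hr : 0 < r) {x : ℝ} (hx : 0 ≤ x) :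
    x ^ r * Real.exp (-x) ≤ (r : ℝ) ^ r * Real.exp (-r) := by
  have hr' : (0 : ℝ) < r := by exact_mod_cast hr
  have h1 : x / r ≤ Real.exp (x / r - 1) := by linarith [Real.add_one_le_exp (x / r - 1)]
  have h2 := pow_le_pow_left₀ (by positivity) h1 r
  rw [← Real.exp_nat_mul, div_pow, div_le_iff₀ (by positivity)] at h2
  have h3 : (r : ℝ) * (x / r - 1) = x - r := by field_simp
  rw [h3] at h2
  calc x ^ r * Real.exp (-x) ≤ Real.exp (x - r) * (r : ℝ) ^ r * Real.exp (-x) := by gcongr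
    _ = (r : ℝ) ^ r * (Real.exp (x - r) * Real.exp (-x)) := by ring
    _ = _ := by rw [← Real.exp_add]; ring_nf

/-- The value `√r e^{-r} r^r / r!` that a Poisson variable of mean `r` contributes. -/
noncomputable def poissonPeak (r : ℕ) : ℝ :=
  √r * ((r : ℝ) ^ r * Real.exp (-r) / r.factorial)

theorem poissonPeak_pos {r : ℕ} (hr : 0 < r) : 0 < poissonPeak r := by
  unfold poissonPeak
  positivity

variable {ι : Type*} (s : Finset ι) (b : ι → ℝ)

theorem sum_div_one_add_le (hb : ∀ i ∈ s, 0 ≤ b i) : ∑ i ∈ s, b i / (1 + b i) ≤ ∑ i ∈ s, b i := by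
  refine Finset.sum_le_sum fun i hi => div_le_self (hb i hi) (by linarith [hb i hi])

theorem sum_sub_sum_sq_le (hb : ∀ i ∈ s, 0 ≤ b i) : ∑ i ∈ s, b i - ∑ i ∈ s, b i ^ 2 ≤ ∑ i ∈ s, b i / (1 + b i) := by
  rw [← Finset.sum_sub_distrib]
  refine Finset.sum_le_sum fun i hi => ?_
  have := hb i hi
  rw [le_div_iff₀ (by linarith)]
  nlinarith [pow_nonneg this 3]

theorem variance_le (hb : ∀ i ∈ s, 0 ≤ b i) : ∑ i ∈ s, b i / (1 + b i) ^ 2 ≤ ∑ i ∈ s, b i / (1 + b i) := by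
  refine Finset.sum_le_sum fun i hi => ?_
  have := hb i hi
  gcongr
  nlinarith

theorem le_variance (hb : ∀ i ∈ s, 0 ≤ b i) :
    ∑ i ∈ s, b i / (1 + b i) - ∑ i ∈ s, b i ^ 2 ≤ ∑ i ∈ s, b i / (1 + b i) ^ 2 := by
  rw [← Finset.sum_sub_distrib]
  refine Finset.sum_le_sum fun i hi => ?_
  have := hb i hi
  have h1 : b i / (1 + b i) - b i / (1 + b i) ^ 2 = b i ^ 2 / (1 + b i) ^ 2 := by
    field_simp
    ring
  have h2 : b i ^ 2 / (1 + b i) ^ 2 ≤ b i ^ 2 :=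
    div_le_self (sq_nonneg _) (by nlinarith)
  linarith

/-- With S = ∑ b and D = ∑ b²: the coefficient is at most S^r / r!, the variance at most r, and the
product at least exp(S - D/2). Maximality of x^r e^(-x) at r then leaves only the factor exp(D/2) ≤
1 + D. -/
theorem normalizedCoeff_le_poissonPeak (hb : ∀ i ∈ s, 0 ≤ b i) {r : ℕ} (hr : 0 < r)
    (hmean : ∑ i ∈ s, b i / (1 + b i) = r) (hD : ∑ i ∈ s, b i ^ 2 ≤ 1) :
    normalizedCoeff s b r ≤ poissonPeak r * (1 + ∑ i ∈ s, b i ^ 2) := by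
  set S := ∑ i ∈ s, b i with hS
  set D := ∑ i ∈ s, b i ^ 2 with hDdef
  have hS0 : 0 ≤ S := Finset.sum_nonneg hb
  have hD0 : 0 ≤ D := Finset.sum_nonneg fun _ _ => sq_nonneg _
  have h1 := factorial_mul_linProd_coeff_le s b hb r
  have h0 := linProd_coeff_nonneg s b hb r
  have h2 : √(∑ i ∈ s, b i / (1 + b i) ^ 2) ≤ √r :=
    Real.sqrt_le_sqrt ((variance_le s b hb).trans hmean.le)
  have h3 : Real.exp (S - D / 2) ≤ ∏ i ∈ s, (1 + b i) := by
    have : S - D / 2 = ∑ i ∈ s, (b i - b i ^ 2 / 2) := by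
      rw [Finset.sum_sub_distrib, ← Finset.sum_div]
    rw [this, Real.exp_sum]
    exact Finset.prod_le_prod (fun _ _ => (Real.exp_pos _).le)
      fun i hi => exp_sub_sq_div_two_le (hb i hi)
  have h4 := pow_mul_exp_neg_le r hr hS0
  have h5 : Real.exp (D / 2) ≤ 1 + D := by
    have := Real.add_one_le_exp (-(D / 2))
    have h6 : Real.exp (D / 2) * Real.exp (-(D / 2)) = 1 := by rw [← Real.exp_add]; simp
    nlinarith [Real.exp_pos (D / 2)]
  have hf : (0 : ℝ) < r.factorial := by positivity
  have h1' : (linProd s b).coeff r ≤ S ^ r / r.factorial := by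
    rw [le_div_iff₀ hf]; linarith
  calc normalizedCoeff s b r
      ≤ S ^ r / r.factorial * √r / Real.exp (S - D / 2) := by
        unfold normalizedCoeff
        gcongr
    _ = √r * (S ^ r * Real.exp (-S) / r.factorial) * Real.exp (D / 2) := by
        rw [div_eq_mul_inv _ (Real.exp _), ← Real.exp_neg,
          show -(S - D / 2) = -S + D / 2 by ring, Real.exp_add]
        ring
    _ ≤ √r * ((r : ℝ) ^ r * Real.exp (-r) / r.factorial) * (1 + D) := by gcongr

/-- Here r ≤ S ≤ r + D. The coefficient, the square root of the variance and exp(-S) lose at most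
the factors 1 - D/2, 1 - D and 1 - D, whose product is at least 1 - 3D. -/
theorem poissonPeak_le_normalizedCoeff (hb : ∀ i ∈ s, 0 ≤ b i) {r : ℕ} (hr : 0 < r)
    (hmean : ∑ i ∈ s, b i / (1 + b i) = r) (hD : ∑ i ∈ s, b i ^ 2 ≤ 1) :
    poissonPeak r * (1 - 3 * ∑ i ∈ s, b i ^ 2) ≤ normalizedCoeff s b r := by
  have hSr := hmean ▸ sum_div_one_add_le s b hb
  have hSD := hmean ▸ sum_sub_sum_sq_le s b hb
  have hV := hmean ▸ le_variance s b hb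
  have h1 := le_factorial_mul_linProd_coeff s b hb r
  set S := ∑ i ∈ s, b i with hS
  set D := ∑ i ∈ s, b i ^ 2 with hDdef
  have hr1 : (1 : ℝ) ≤ r := by exact_mod_cast hr
  have hD0 : 0 ≤ D := Finset.sum_nonneg fun _ _ => sq_nonneg _
  have hS0 : 0 < S := by linarith
  have h1' : (r : ℝ) ^ r * (1 - D / 2) ≤ r.factorial * (linProd s b).coeff r := by
    refine le_trans ?_ h1
    have h2 : (r : ℝ) * (r - 1) * S ^ (r - 2) ≤ S ^ r := by
      rcases r with _ | _ | r
      · simp at hr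
      · simp [hS0.le]
      · rw [show r + 1 + 1 - 2 = r by omega, show S ^ (r + 1 + 1) = S * S * S ^ r by ring]
        push_cast at hSr ⊢
        have h3 : (r : ℝ) + 1 + 1 - 1 ≤ S := by linarith
        have h4 : (0 : ℝ) ≤ (r : ℝ) + 1 + 1 - 1 := by linarith [(Nat.cast_nonneg r : (0 : ℝ) ≤ r)]
        gcongr
    have h3 : (r : ℝ) ^ r ≤ S ^ r := by gcongr
    have h4 := mul_le_mul_of_nonneg_left h2 hD0
    have h5 : (r : ℝ) ^ r * (1 - D / 2) ≤ S ^ r * (1 - D / 2) := by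
      gcongr
      linarith
    linarith
  have h2 : √r * (1 - D) ≤ √(∑ i ∈ s, b i / (1 + b i) ^ 2) := by
    refine Real.le_sqrt_of_sq_le ?_
    rw [mul_pow, Real.sq_sqrt (by linarith)]
    nlinarith [mul_nonneg hD0 (sub_nonneg.2 hD)]
  have h3 : ∏ i ∈ s, (1 + b i) ≤ Real.exp S := by
    rw [hS, Real.exp_sum]
    refine Finset.prod_le_prod (fun i hi => by linarith [hb i hi]) fun i hi => ?_
    linarith [Real.add_one_le_exp (b i)]
  have h4 : Real.exp (-r) * (1 - D) ≤ Real.exp (-S) := by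
    have h5 := Real.add_one_le_exp (r - S)
    rw [show -S = -(r : ℝ) + (r - S) by ring, Real.exp_add]
    gcongr
    linarith
  have hP : 0 < ∏ i ∈ s, (1 + b i) := Finset.prod_pos fun i hi => by linarith [hb i hi]
  have hf : (0 : ℝ) < r.factorial := by positivity
  have h1'' : (r : ℝ) ^ r * (1 - D / 2) / r.factorial ≤ (linProd s b).coeff r := by
    rw [div_le_iff₀ hf]; linarith
  have hpoly : 1 - 3 * D ≤ (1 - D / 2) * (1 - D) * (1 - D) := by
    nlinarith [mul_nonneg hD0 hD0, mul_nonneg (mul_nonneg hD0 hD0) (sub_nonneg.2 hD)]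
  have hD1 : 0 ≤ 1 - D := by linarith
  have hD2 : 0 ≤ 1 - D / 2 := by linarith
  calc poissonPeak r * (1 - 3 * D)
      ≤ poissonPeak r * ((1 - D / 2) * (1 - D) * (1 - D)) := by
        have := (poissonPeak_pos hr).le
        gcongr
    _ = ((r : ℝ) ^ r * (1 - D / 2) / r.factorial) * (√r * (1 - D)) *
          (Real.exp (-r) * (1 - D)) := by unfold poissonPeak; ring
    _ ≤ (linProd s b).coeff r * √(∑ i ∈ s, b i / (1 + b i) ^ 2) * Real.exp (-S) := by
        have := linProd_coeff_nonneg s b hb r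
        gcongr
    _ = (linProd s b).coeff r * √(∑ i ∈ s, b i / (1 + b i) ^ 2) / Real.exp S := by
        rw [Real.exp_neg]; rfl
    _ ≤ normalizedCoeff s b r := by
        unfold normalizedCoeff
        have := linProd_coeff_nonneg s b hb r
        gcongr

/-- If the mean is small compared with `(∑ b)² / ∑ b²`, the squares of the odds are summably
small. -/
theorem sum_sq_mul_le_of_mean (a : ι → ℝ) (ha : ∀ i ∈ s, 0 < a i) {t : ℝ} (ht : 0 ≤ t) {ρ : ℝ}
    (hmean : ∑ i ∈ s, a i * t / (1 + a i * t) = ρ)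
    (hsmall : ρ * ∑ i ∈ s, a i ^ 2 ≤ (∑ i ∈ s, a i) ^ 2 / 2) :
    ∑ i ∈ s, (a i * t) ^ 2 ≤ 4 * (ρ ^ 2 * (∑ i ∈ s, a i ^ 2) / (∑ i ∈ s, a i) ^ 2) := by
  rcases s.eq_empty_or_nonempty with rfl | hne
  · simp
  have hS0 : 0 < ∑ i ∈ s, a i := Finset.sum_pos ha hne
  -- Cauchy–Schwarz, writing a² as the product of a(1 + at) and a/(1 + at).
  have hCS : (∑ i ∈ s, a i) ^ 2 / (∑ i ∈ s, a i * (1 + a i * t)) ≤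
      ∑ i ∈ s, a i / (1 + a i * t) := by
    have := Finset.sum_sq_le_sum_mul_sum_of_sq_le_mul s (r := a)
      (f := fun i => a i * (1 + a i * t)) (g := fun i => a i / (1 + a i * t))
      (fun i hi => by have := ha i hi; positivity) (fun i hi => by have := ha i hi; positivity)
      (fun i hi => by have := ha i hi; field_simp; rfl)
    have hpos : 0 < ∑ i ∈ s, a i * (1 + a i * t) :=
      Finset.sum_pos (fun i hi => by have := ha i hi; positivity) hne
    rw [div_le_iff₀ hpos]
    linarith
  have e1 : ∑ i ∈ s, a i * (1 + a i * t) = ∑ i ∈ s, a i + t * ∑ i ∈ s, a i ^ 2 := by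
    rw [Finset.mul_sum, ← Finset.sum_add_distrib]
    exact Finset.sum_congr rfl fun i _ => by ring
  have e2 : ∑ i ∈ s, a i * t / (1 + a i * t) = t * ∑ i ∈ s, a i / (1 + a i * t) := by
    rw [Finset.mul_sum]
    exact Finset.sum_congr rfl fun i _ => by ring
  have e3 : ∑ i ∈ s, (a i * t) ^ 2 = t ^ 2 * ∑ i ∈ s, a i ^ 2 := by
    rw [Finset.mul_sum]
    exact Finset.sum_congr rfl fun i _ => by ring
  have hT0 : 0 ≤ ∑ i ∈ s, a i ^ 2 := Finset.sum_nonneg fun _ _ => sq_nonneg _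
  rw [e1] at hCS
  rw [e2] at hmean
  rw [e3]
  set S := ∑ i ∈ s, a i
  set T := ∑ i ∈ s, a i ^ 2
  have h1 : t * (S ^ 2 / (S + t * T)) ≤ ρ := by
    rw [← hmean]; gcongr
  -- The previous bound reads tS² ≤ ρS + tρT, and the smallness hypothesis absorbs tρT into half of
  -- the left side.
  have h2 : t * S ≤ 2 * ρ := by
    rw [← mul_div_assoc, div_le_iff₀ (by positivity)] at h1
    have h3 : t * S ^ 2 ≤ ρ * S + t * (S ^ 2 / 2) := by
      nlinarith [mul_le_mul_of_nonneg_left hsmall ht]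
    have h4 : (t * S) * S ≤ 2 * ρ * S := by nlinarith
    exact le_of_mul_le_mul_right h4 hS0
  have h5 : (t * S) ^ 2 ≤ (2 * ρ) ^ 2 := by gcongr
  rw [← mul_div_assoc, le_div_iff₀ (by positivity)]
  nlinarith [mul_le_mul_of_nonneg_right h5 hT0]

end PoissonRegime

/-! ### Characteristic functions of centred Bernoulli sums -/

open Complex in
/-- The characteristic function of a centred Bernoulli variable. -/
noncomputable def bernoulliChar (p θ : ℝ) : ℂ :=
  (1 - p) * exp (-(p * (θ * I))) + p * exp ((1 - p) * (θ * I))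

section LocalLimit

open Complex in
-- The squared modulus of 1 - p + p e^(iθ) is 1 - 2p(1-p)(1 - cos θ), to which 1 + x ≤ e^x applies.
theorem norm_bernoulliChar_le {p : ℝ} (θ : ℝ) :
    ‖bernoulliChar p θ‖ ≤ Real.exp (-(p * (1 - p) * (1 - Real.cos θ))) := by
  have h1 : bernoulliChar p θ = exp (-(p * (θ * I))) * ((1 - p) + p * exp (θ * I)) := by
    have h0 : exp ((1 - p) * (θ * I)) = exp (-(p * (θ * I))) * exp (θ * I) := by
      rw [← exp_add]; ring_nf
    rw [bernoulliChar, h0]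
    ring
  have h2 : ‖exp (-(p * (θ * I)))‖ = 1 := by
    rw [show -((p : ℂ) * (θ * I)) = ((-(p * θ) : ℝ) : ℂ) * I by push_cast; ring]
    exact norm_exp_ofReal_mul_I _
  have h3 : ‖((1 - p) + p * exp (θ * I) : ℂ)‖ ^ 2 = 1 - 2 * (p * (1 - p)) * (1 - Real.cos θ) := by
    rw [exp_mul_I, ← normSq_eq_norm_sq, normSq_apply]
    simp [← ofReal_cos, ← ofReal_sin]
    linear_combination p ^ 2 * Real.sin_sq_add_cos_sq θ
  rw [h1, norm_mul, h2, one_mul]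
  refine le_of_sq_le_sq ?_ (Real.exp_pos _).le
  rw [h3, ← Real.exp_nat_mul]
  refine le_trans ?_ (Real.add_one_le_exp _)
  push_cast
  linarith

open Complex in
-- Centring kills the linear term. The constant 5/96 is that of the fourth-order remainder of exp,
-- and the fourth powers combine through (1-p)p⁴ + p(1-p)⁴ ≤ p(1-p).
theorem norm_bernoulliChar_sub_taylor_le {p θ : ℝ} (hp0 : 0 ≤ p) (hp1 : p ≤ 1) (hθ : |θ| ≤ 1) :
    ‖bernoulliChar p θ - 1 - (-((p * (1 - p) * θ ^ 2 / 2 : ℝ) : ℂ) -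
      ((p * (1 - p) * (1 - 2 * p) * θ ^ 3 / 6 : ℝ) : ℂ) * I)‖ ≤
      5 / 96 * (p * (1 - p) * θ ^ 4) := by
  have hq0 : 0 ≤ 1 - p := by linarith
  have hx : ‖-((p : ℂ) * (θ * I))‖ = p * |θ| := by simp [abs_of_nonneg hp0]
  have hy : ‖((1 - p : ℂ) * (θ * I))‖ = (1 - p) * |θ| := by
    have : ‖(1 - p : ℂ)‖ = 1 - p := by
      rw [← ofReal_one, ← ofReal_sub, norm_real, Real.norm_eq_abs, abs_of_nonneg hq0]
    simp [this]
  have bx := exp_bound (x := -((p : ℂ) * (θ * I)))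
    (by rw [hx]; nlinarith [abs_nonneg θ]) (n := 4) (by norm_num)
  have b_y := exp_bound (x := ((1 - p : ℂ) * (θ * I)))
    (by rw [hy]; nlinarith [abs_nonneg θ]) (n := 4) (by norm_num)
  rw [hx] at bx
  rw [hy] at b_y
  have e : bernoulliChar p θ - 1 - (-((p * (1 - p) * θ ^ 2 / 2 : ℝ) : ℂ) -
      ((p * (1 - p) * (1 - 2 * p) * θ ^ 3 / 6 : ℝ) : ℂ) * I) =
      ((1 - p : ℝ) : ℂ) * (exp (-((p : ℂ) * (θ * I))) -
        ∑ m ∈ Finset.range 4, (-((p : ℂ) * (θ * I))) ^ m / (m.factorial : ℂ)) +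
      (p : ℂ) * (exp ((1 - p : ℂ) * (θ * I)) -
        ∑ m ∈ Finset.range 4, ((1 - p : ℂ) * (θ * I)) ^ m / (m.factorial : ℂ)) := by
    simp only [bernoulliChar, Finset.sum_range_succ, Finset.sum_range_zero, Nat.factorial]
    have hI2 : (I : ℂ) ^ 2 = -1 := I_sq
    have hI3 : (I : ℂ) ^ 3 = -I := I_pow_three
    push_cast
    linear_combination (((1 - p) * p ^ 2 + p * (1 - p) ^ 2) * θ ^ 2 / 2 : ℂ) * hI2 +
      ((-(1 - p) * p ^ 3 + p * (1 - p) ^ 3) * θ ^ 3 / 6 : ℂ) * hI3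
  rw [e]
  refine (norm_add_le _ _).trans ?_
  rw [norm_mul, norm_mul, norm_real, norm_real, Real.norm_eq_abs, Real.norm_eq_abs,
    abs_of_nonneg hp0, abs_of_nonneg hq0]
  have h1 := mul_le_mul_of_nonneg_left bx hq0
  have h2 := mul_le_mul_of_nonneg_left b_y hp0
  refine (add_le_add h1 h2).trans ?_
  have hθ4 : |θ| ^ 4 = θ ^ 4 := by rw [← abs_pow, abs_of_nonneg (by positivity)]
  have h3 : p ^ 3 + (1 - p) ^ 3 ≤ 1 := by nlinarith
  have h4 := mul_le_mul_of_nonneg_left h3 (by positivity : 0 ≤ 5 / 96 * (p * (1 - p) * θ ^ 4))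
  rw [mul_pow, mul_pow, hθ4]
  norm_num [Nat.factorial]
  ring_nf at h4 ⊢
  linarith

open Complex in
-- The value is 1 + w with ‖w‖ ≤ 3/16, so its logarithm is w + O(‖w‖²), and ‖w‖² is of order
-- p(1-p)θ⁴. The two errors add up to 5/96 + 9/104 ≤ 3/20.
theorem bernoulliChar_eq_exp {p θ : ℝ} (hp0 : 0 ≤ p) (hp1 : p ≤ 1) (hθ : |θ| ≤ 1) :
    ∃ R : ℂ, ‖R‖ ≤ 3 / 20 * (p * (1 - p) * θ ^ 4) ∧
      bernoulliChar p θ = exp (-((p * (1 - p) * θ ^ 2 / 2 : ℝ) : ℂ) -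
        ((p * (1 - p) * (1 - 2 * p) * θ ^ 3 / 6 : ℝ) : ℂ) * I + R) := by
  have hB := norm_bernoulliChar_sub_taylor_le hp0 hp1 hθ
  set T : ℂ := -((p * (1 - p) * θ ^ 2 / 2 : ℝ) : ℂ) -
        ((p * (1 - p) * (1 - 2 * p) * θ ^ 3 / 6 : ℝ) : ℂ) * I with hT
  set w := bernoulliChar p θ - 1 with hw
  set v := p * (1 - p) with hv
  have hq0 : 0 ≤ 1 - p := by linarith
  have hv0 : 0 ≤ v := mul_nonneg hp0 hq0
  have hv1 : v ≤ 1 / 4 := by nlinarith [sq_nonneg (p - 1 / 2)]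
  have hθ2 : θ ^ 2 ≤ 1 := by rw [← sq_abs]; exact pow_le_one₀ (abs_nonneg _) hθ
  have hθ4 : θ ^ 4 ≤ θ ^ 2 := by nlinarith [sq_nonneg θ]
  have hθ3 : |θ| ^ 3 ≤ θ ^ 2 := by
    rw [← sq_abs]; nlinarith [sq_nonneg (|θ|), abs_nonneg θ]
  have hTn : ‖T‖ ≤ v * θ ^ 2 / 2 + v * θ ^ 2 / 6 := by
    refine (norm_sub_le _ _).trans (add_le_add ?_ ?_)
    · rw [norm_neg, norm_real, Real.norm_eq_abs, abs_of_nonneg (by positivity)]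
    · rw [norm_mul, norm_I, mul_one, norm_real, Real.norm_eq_abs, abs_div, abs_mul, abs_mul,
        abs_of_nonneg hv0, abs_pow]
      have : |1 - 2 * p| ≤ 1 := abs_le.2 ⟨by linarith, by linarith⟩
      have h6 : |(6 : ℝ)| = 6 := by norm_num
      rw [h6]
      have : |1 - 2 * p| * |θ| ^ 3 ≤ 1 * θ ^ 2 := by gcongr
      have := mul_le_mul_of_nonneg_left this hv0
      linarith
  have hwn : ‖w‖ ≤ 3 / 4 * (v * θ ^ 2) := by
    have h1 : ‖w‖ ≤ ‖w - T‖ + ‖T‖ := by simpa using norm_add_le (w - T) T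
    have := mul_le_mul_of_nonneg_left hθ4 hv0
    nlinarith
  have hw1 : ‖w‖ ≤ 3 / 16 := by nlinarith [sq_nonneg θ]
  have hlog := norm_log_one_add_sub_self_le (z := w) (by linarith)
  have hinv : (1 - ‖w‖)⁻¹ ≤ 16 / 13 := by
    rw [inv_le_comm₀ (by linarith) (by norm_num)]; linarith
  have hw2 : ‖w‖ ^ 2 ≤ 9 / 64 * (v * θ ^ 4) := by
    have h1 : ‖w‖ ^ 2 ≤ (3 / 4 * (v * θ ^ 2)) ^ 2 := by gcongr
    have h2 := mul_le_mul_of_nonneg_left hv1 (by positivity : 0 ≤ 9 / 16 * (v * θ ^ 4))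
    calc _ ≤ _ := h1
      _ = 9 / 16 * (v * θ ^ 4) * v := by ring
      _ ≤ _ := by linarith
  have hlog' : ‖log (1 + w) - w‖ ≤ 9 / 64 * (v * θ ^ 4) * (16 / 13) / 2 := by
    refine hlog.trans ?_
    have : 0 ≤ (1 - ‖w‖)⁻¹ := inv_nonneg.2 (by linarith)
    gcongr
  have hne : 1 + w ≠ 0 := by
    intro h
    have : w = -1 := by linear_combination h
    rw [this] at hw1
    norm_num at hw1
  refine ⟨log (1 + w) - T, ?_, ?_⟩
  · have : log (1 + w) - T = (log (1 + w) - w) + (w - T) := by ring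
    rw [this]
    refine (norm_add_le _ _).trans ?_
    have : 0 ≤ v * θ ^ 4 := by positivity
    linarith
  · rw [add_sub_cancel, exp_log hne, hw]
    ring

variable {ι : Type*}

open Complex in
-- The cubic terms are purely imaginary, so Re z is of order θ⁴ although z is only of order |θ|³.
-- This is what makes the final error O(1/V) rather than O(1/√V).
theorem prod_bernoulliChar_eq_exp (s : Finset ι) (p : ι → ℝ) (hp0 : ∀ i ∈ s, 0 ≤ p i)
    (hp1 : ∀ i ∈ s, p i ≤ 1) {θ : ℝ} (hθ : |θ| ≤ 1) :
    ∃ z : ℂ, |z.re| ≤ 3 / 20 * ((∑ i ∈ s, p i * (1 - p i)) * θ ^ 4) ∧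
      ‖z‖ ≤ (∑ i ∈ s, p i * (1 - p i)) * |θ| ^ 3 / 3 ∧
      ∏ i ∈ s, bernoulliChar (p i) θ =
        exp (((-((∑ i ∈ s, p i * (1 - p i)) * θ ^ 2 / 2) : ℝ) : ℂ) + z) := by
  classical
  induction s using Finset.induction_on with
  | empty => exact ⟨0, by simp⟩
  | insert i s hi ih =>
    obtain ⟨z, hz1, hz2, hz3⟩ := ih (fun j hj => hp0 j (Finset.mem_insert_of_mem hj))
      (fun j hj => hp1 j (Finset.mem_insert_of_mem hj))
    have hi0 := hp0 i (Finset.mem_insert_self _ _)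
    have hi1 := hp1 i (Finset.mem_insert_self _ _)
    obtain ⟨R, hR1, hR2⟩ := bernoulliChar_eq_exp hi0 hi1 hθ
    rw [Finset.prod_insert hi, Finset.sum_insert hi]
    set V := ∑ i ∈ s, p i * (1 - p i)
    have hv0 : 0 ≤ p i * (1 - p i) := mul_nonneg hi0 (by linarith)
    refine ⟨z - ((p i * (1 - p i) * (1 - 2 * p i) * θ ^ 3 / 6 : ℝ) : ℂ) * I + R, ?_, ?_, ?_⟩
    · have h1 : (z - ((p i * (1 - p i) * (1 - 2 * p i) * θ ^ 3 / 6 : ℝ) : ℂ) * I + R).re =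
          z.re + R.re := by
        simp only [add_re, sub_re, mul_re, ofReal_re, ofReal_im, I_re, I_im]
        ring
      rw [h1]
      refine (abs_add_le _ _).trans ?_
      have := abs_re_le_norm R
      linarith
    · refine (norm_add_le _ _).trans ?_
      have h1 := norm_sub_le z (((p i * (1 - p i) * (1 - 2 * p i) * θ ^ 3 / 6 : ℝ) : ℂ) * I)
      have h2 : ‖((p i * (1 - p i) * (1 - 2 * p i) * θ ^ 3 / 6 : ℝ) : ℂ) * I‖ ≤
          p i * (1 - p i) * |θ| ^ 3 / 6 := by
        rw [norm_mul, norm_I, mul_one, norm_real, Real.norm_eq_abs, abs_div, abs_mul, abs_mul,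
          abs_of_nonneg hv0, abs_pow]
        have h3 : |1 - 2 * p i| ≤ 1 := abs_le.2 ⟨by linarith, by linarith⟩
        have h6 : |(6 : ℝ)| = 6 := by norm_num
        rw [h6]
        have : p i * (1 - p i) * |1 - 2 * p i| * |θ| ^ 3 ≤ p i * (1 - p i) * 1 * |θ| ^ 3 := by
          gcongr
        linarith
      have h4 : θ ^ 4 ≤ |θ| ^ 3 := by
        have : θ ^ 4 = |θ| ^ 4 := by rw [← abs_pow, abs_of_nonneg (by positivity)]
        rw [this]
        nlinarith [pow_nonneg (abs_nonneg θ) 3]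
      have h5 := mul_le_mul_of_nonneg_left h4 hv0
      have h6 : 0 ≤ p i * (1 - p i) * |θ| ^ 3 := by positivity
      linarith
    · rw [hz3, hR2, ← exp_add]
      congr 1
      push_cast
      ring

open Complex in
theorem norm_prod_bernoulliChar_le (s : Finset ι) (p : ι → ℝ) (hp0 : ∀ i ∈ s, 0 ≤ p i)
    (hp1 : ∀ i ∈ s, p i ≤ 1) {θ : ℝ} (hθ : |θ| ≤ Real.pi) :
    ‖∏ i ∈ s, bernoulliChar (p i) θ‖ ≤
      Real.exp (-((∑ i ∈ s, p i * (1 - p i)) * θ ^ 2 / 5)) := by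
  have h1 : θ ^ 2 / 5 ≤ 1 - Real.cos θ := by
    have h2 := Real.cos_le_one_sub_mul_cos_sq hθ
    have h3 : 1 / 5 ≤ 2 / Real.pi ^ 2 := by
      rw [div_le_div_iff₀ (by norm_num) (by positivity)]
      nlinarith [Real.pi_lt_d2, Real.pi_pos]
    nlinarith [sq_nonneg θ]
  rw [norm_prod, mul_div_assoc, Finset.sum_mul, ← Finset.sum_neg_distrib, Real.exp_sum]
  refine Finset.prod_le_prod (fun _ _ => norm_nonneg _) fun i hi => ?_
  refine (norm_bernoulliChar_le θ).trans (Real.exp_le_exp.2 (neg_le_neg ?_))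
  exact mul_le_mul_of_nonneg_left h1 (mul_nonneg (hp0 i hi) (by linarith [hp1 i hi]))

theorem pow_mul_exp_neg_div_twelve_le {y : ℝ} (hy : 0 ≤ y) (n : ℕ) :
    y ^ n * Real.exp (-(y / 12)) ≤ 12 ^ n * n.factorial := by
  have h := Real.pow_div_factorial_le_exp (y / 12) (by positivity) n
  rw [div_le_iff₀ (by positivity), div_pow, div_le_iff₀ (by positivity)] at h
  calc y ^ n * Real.exp (-(y / 12))
      ≤ (Real.exp (y / 12) * n.factorial * 12 ^ n) * Real.exp (-(y / 12)) := by gcongr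
    _ = (Real.exp (y / 12) * Real.exp (-(y / 12))) * (12 ^ n * n.factorial) := by ring
    _ = _ := by rw [← Real.exp_add]; simp

open Complex in
-- With y = Vθ², Re(e^z) - 1 is Re z plus a remainder of size ‖z‖² e^‖z‖, that is O(y²/V) + O(y³/V)
-- e^(y/3).
theorem abs_re_prod_bernoulliChar_sub_le_of_abs_le_one (s : Finset ι) (p : ι → ℝ)
    (hp0 : ∀ i ∈ s, 0 ≤ p i) (hp1 : ∀ i ∈ s, p i ≤ 1) {V : ℝ}
    (hV : V = ∑ i ∈ s, p i * (1 - p i)) (hV0 : 0 < V) {θ : ℝ} (hθ : |θ| ≤ 1) :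
    |(∏ i ∈ s, bernoulliChar (p i) θ).re - Real.exp (-(V * θ ^ 2 / 2))| ≤
      1200 / V * Real.exp (-(V * θ ^ 2 / 12)) := by
  obtain ⟨z, hz1, hz2, hz3⟩ := prod_bernoulliChar_eq_exp s p hp0 hp1 hθ
  rw [← hV] at hz1 hz2 hz3
  have hθ2 : θ ^ 2 ≤ 1 := by rw [← sq_abs]; exact pow_le_one₀ (abs_nonneg _) hθ
  set y := V * θ ^ 2 with hy
  have hy0 : 0 ≤ y := mul_nonneg hV0.le (sq_nonneg _)
  have e1 : V * θ ^ 4 = y ^ 2 / V := by rw [hy]; field_simp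
  have e2 : (V * |θ| ^ 3 / 3) ^ 2 = y ^ 3 / V / 9 := by
    have : (|θ| ^ 3) ^ 2 = θ ^ 6 := by
      rw [show (|θ| ^ 3) ^ 2 = (|θ| ^ 2) ^ 3 by ring, sq_abs]
      ring
    rw [div_pow, mul_pow, this, hy]
    field_simp
    norm_num
  have h3 : ‖z‖ ≤ y / 3 := by
    refine hz2.trans ?_
    have : |θ| ^ 3 ≤ θ ^ 2 := by rw [← sq_abs]; nlinarith [sq_nonneg (|θ|), abs_nonneg θ]
    have := mul_le_mul_of_nonneg_left this hV0.le
    rw [hy]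
    linarith
  have h4 : ‖z‖ ^ 2 ≤ y ^ 3 / V / 9 := by rw [← e2]; gcongr
  have h5 := norm_exp_sub_sum_le_norm_mul_exp z 2
  have h6 : |(exp z).re - 1| ≤ 3 / 20 * (y ^ 2 / V) + y ^ 3 / V / 9 * Real.exp (y / 3) := by
    have h7 : (exp z).re - 1 = z.re +
        (exp z - ∑ m ∈ Finset.range 2, z ^ m / (m.factorial : ℂ)).re := by
      simp [Finset.sum_range_succ]
      ring
    rw [h7]
    refine (abs_add_le _ _).trans (add_le_add (e1 ▸ hz1) ?_)
    refine (abs_re_le_norm _).trans (h5.trans ?_)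
    gcongr
  have h8 : (∏ i ∈ s, bernoulliChar (p i) θ).re - Real.exp (-(y / 2)) =
      Real.exp (-(y / 2)) * ((exp z).re - 1) := by
    rw [hz3, exp_add, ← ofReal_exp, re_ofReal_mul]
    ring
  rw [h8, abs_mul, abs_of_pos (Real.exp_pos _)]
  have g2 := pow_mul_exp_neg_div_twelve_le hy0 2
  have g3 := pow_mul_exp_neg_div_twelve_le hy0 3
  norm_num [Nat.factorial] at g2 g3
  -- Of the two factors exp(-y/12), one absorbs the powers of y and the other is kept for
  -- integration. The constant is 3/20 · 288 + 10368/9 ≤ 1200.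
  have k1 : Real.exp (-(y / 2)) ≤ Real.exp (-(y / 12)) * Real.exp (-(y / 12)) := by
    rw [← Real.exp_add]; exact Real.exp_le_exp.2 (by linarith)
  have k2 : Real.exp (-(y / 2)) * Real.exp (y / 3) =
      Real.exp (-(y / 12)) * Real.exp (-(y / 12)) := by
    rw [← Real.exp_add, ← Real.exp_add]; ring_nf
  calc Real.exp (-(y / 2)) * |(exp z).re - 1|
      ≤ Real.exp (-(y / 2)) * (3 / 20 * (y ^ 2 / V) + y ^ 3 / V / 9 * Real.exp (y / 3)) := by
        gcongr
    _ = 3 / 20 * (y ^ 2 / V) * Real.exp (-(y / 2)) +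
        y ^ 3 / V / 9 * (Real.exp (-(y / 2)) * Real.exp (y / 3)) := by ring
    _ ≤ 3 / 20 * (y ^ 2 / V) * (Real.exp (-(y / 12)) * Real.exp (-(y / 12))) +
        y ^ 3 / V / 9 * (Real.exp (-(y / 12)) * Real.exp (-(y / 12))) := by
        rw [k2]; gcongr
    _ = (3 / 20 * (y ^ 2 * Real.exp (-(y / 12))) + (y ^ 3 * Real.exp (-(y / 12))) / 9) / V *
        Real.exp (-(y / 12)) := by ring
    _ ≤ _ := by
        gcongr
        linarith

open Complex in
-- For |θ| > 1 both terms are at most exp(-y/5) with y = Vθ² ≥ V, and one factor exp(-y/12) ≤ 12/V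
-- supplies the gain. The indicator permits integration over the whole line.
theorem abs_re_prod_bernoulliChar_sub_le (s : Finset ι) (p : ι → ℝ)
    (hp0 : ∀ i ∈ s, 0 ≤ p i) (hp1 : ∀ i ∈ s, p i ≤ 1) {V : ℝ}
    (hV : V = ∑ i ∈ s, p i * (1 - p i)) (hV0 : 0 < V) (θ : ℝ) :
    |Set.indicator (Set.Ioc (-Real.pi) Real.pi)
        (fun θ => (∏ i ∈ s, bernoulliChar (p i) θ).re) θ - Real.exp (-(V * θ ^ 2 / 2))| ≤
      1200 / V * Real.exp (-(V * θ ^ 2 / 12)) := by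
  rcases le_or_gt |θ| 1 with hθ | hθ
  · have hmem : θ ∈ Set.Ioc (-Real.pi) Real.pi := by
      have := abs_le.1 hθ
      have := Real.pi_gt_three
      constructor <;> linarith
    rw [Set.indicator_of_mem hmem]
    exact abs_re_prod_bernoulliChar_sub_le_of_abs_le_one s p hp0 hp1 hV hV0 hθ
  · have hθ2 : 1 ≤ θ ^ 2 := by rw [← sq_abs]; nlinarith
    have h1 : |Set.indicator (Set.Ioc (-Real.pi) Real.pi)
        (fun θ => (∏ i ∈ s, bernoulliChar (p i) θ).re) θ| ≤ Real.exp (-(V * θ ^ 2 / 5)) := by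
      by_cases hmem : θ ∈ Set.Ioc (-Real.pi) Real.pi
      · rw [Set.indicator_of_mem hmem, hV]
        exact (abs_re_le_norm _).trans
          (norm_prod_bernoulliChar_le s p hp0 hp1 (abs_le.2 ⟨hmem.1.le, hmem.2⟩))
      · rw [Set.indicator_of_notMem hmem, abs_zero]
        exact (Real.exp_pos _).le
    set y := V * θ ^ 2 with hy
    have hyV : V ≤ y := by nlinarith
    have hy0 : 0 < y := by linarith
    have h2 : Real.exp (-(y / 2)) ≤ Real.exp (-(y / 5)) := Real.exp_le_exp.2 (by linarith)
    have h3 : Real.exp (-(y / 5)) ≤ Real.exp (-(y / 12)) * Real.exp (-(y / 12)) := by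
      rw [← Real.exp_add]; exact Real.exp_le_exp.2 (by linarith)
    have g := pow_mul_exp_neg_div_twelve_le hy0.le 1
    norm_num at g
    have h4 : Real.exp (-(y / 12)) ≤ 12 / V := by
      rw [le_div_iff₀ hV0]
      nlinarith [Real.exp_pos (-(y / 12))]
    have h5 := mul_le_mul_of_nonneg_right h4 (Real.exp_pos (-(y / 12))).le
    refine (abs_sub _ _).trans ?_
    rw [abs_of_pos (Real.exp_pos _)]
    have h6 : 0 ≤ 1 / V * Real.exp (-(y / 12)) := by positivity
    ring_nf at h1 h2 h3 h5 h6 ⊢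
    linarith

end LocalLimit

/-! ### Fourier inversion and the local limit theorem -/

section FourierInversion

open Complex in
theorem integral_exp_int_mul_I (n : ℤ) :
    ∫ θ in (-Real.pi)..Real.pi, exp (n * (θ * I)) = if n = 0 then 2 * (Real.pi : ℂ) else 0 := by
  split_ifs with h
  · simp [h]
    ring
  · have hc : (n : ℂ) * I ≠ 0 := mul_ne_zero (Int.cast_ne_zero.2 h) I_ne_zero
    have h1 := integral_exp_mul_complex (a := -Real.pi) (b := Real.pi) hc
    have h2 : ∀ θ : ℝ, (n : ℂ) * (θ * I) = (n : ℂ) * I * θ := fun θ => by ring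
    simp only [h2]
    rw [h1]
    have h3 : exp ((n : ℂ) * I * (Real.pi : ℝ)) = exp ((n : ℂ) * I * ((-Real.pi : ℝ) : ℂ)) := by
      rw [exp_eq_exp_iff_exists_int]
      exact ⟨n, by push_cast; ring⟩
    rw [h3, sub_self, zero_div]

open Complex in
theorem integral_eval_exp_mul_I (P : Polynomial ℂ) (r : ℕ) :
    ∫ θ in (-Real.pi)..Real.pi, P.eval (exp (θ * I)) * exp (-(r * (θ * I))) =
      2 * Real.pi * P.coeff r := by
  induction P using Polynomial.induction_on' with
  | add p q hp hq =>
    simp only [Polynomial.eval_add, add_mul, Polynomial.coeff_add, mul_add]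
    rw [intervalIntegral.integral_add, hp, hq]
    all_goals
      refine Continuous.intervalIntegrable ?_ _ _
      fun_prop
  | monomial n a =>
    have h : ∀ θ : ℝ, (Polynomial.monomial n a).eval (exp (θ * I)) * exp (-(r * (θ * I))) =
        a * exp (((n - r : ℤ) : ℂ) * (θ * I)) := by
      intro θ
      rw [Polynomial.eval_monomial, mul_assoc, ← exp_nat_mul, ← exp_add]
      push_cast
      ring_nf
    simp only [h]
    rw [intervalIntegral.integral_const_mul, integral_exp_int_mul_I, Polynomial.coeff_monomial]
    by_cases hn : n = r
    · simp [hn]; ring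
    · have : ((n : ℤ) - r) ≠ 0 := by omega
      simp [hn, this]

variable {ι : Type*}

open Complex in
-- Since r is the sum of the success probabilities, the factor e^(-irθ) distributes over the product
-- and centres each Bernoulli variable.
theorem prod_one_add_mul_exp (s : Finset ι) (b : ι → ℝ) (hb : ∀ i ∈ s, 0 ≤ b i) {r : ℕ}
    (hmean : ∑ i ∈ s, b i / (1 + b i) = r) (θ : ℝ) :
    (∏ i ∈ s, (1 + (b i : ℂ) * exp (θ * I))) * exp (-(r * (θ * I))) =
      ((∏ i ∈ s, (1 + b i) : ℝ) : ℂ) * ∏ i ∈ s, bernoulliChar (b i / (1 + b i)) θ := by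
  have h1 : exp (-(r * (θ * I))) =
      ∏ i ∈ s, exp (-(((b i / (1 + b i) : ℝ) : ℂ) * (θ * I))) := by
    rw [← exp_sum, Finset.sum_neg_distrib, ← Finset.sum_mul, ← ofReal_sum, hmean, ofReal_natCast]
  rw [h1, ofReal_prod, ← Finset.prod_mul_distrib, ← Finset.prod_mul_distrib]
  refine Finset.prod_congr rfl fun i hi => ?_
  have hne : (1 + b i : ℂ) ≠ 0 := by
    rw [← ofReal_one, ← ofReal_add]
    exact ofReal_ne_zero.2 (by linarith [hb i hi])
  have h2 : exp ((1 - ((b i / (1 + b i) : ℝ) : ℂ)) * (θ * I)) =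
      exp (θ * I) * exp (-(((b i / (1 + b i) : ℝ) : ℂ) * (θ * I))) := by
    rw [← exp_add]; ring_nf
  rw [bernoulliChar, h2]
  push_cast
  field_simp
  ring

open Complex in
theorem normalizedCoeff_eq_integral (s : Finset ι) (b : ι → ℝ) (hb : ∀ i ∈ s, 0 ≤ b i) {r : ℕ}
    (hmean : ∑ i ∈ s, b i / (1 + b i) = r) :
    normalizedCoeff s b r = √(∑ i ∈ s, b i / (1 + b i) ^ 2) / (2 * Real.pi) *
      ∫ θ in (-Real.pi)..Real.pi, (∏ i ∈ s, bernoulliChar (b i / (1 + b i)) θ).re := by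
  have h := integral_eval_exp_mul_I ((linProd s b).map (algebraMap ℝ ℂ)) r
  have h1 : ∀ z : ℂ, ((linProd s b).map (algebraMap ℝ ℂ)).eval z =
      ∏ i ∈ s, (1 + (b i : ℂ) * z) := by
    intro z
    simp [linProd, Polynomial.map_prod, Polynomial.eval_prod]
  simp only [h1, prod_one_add_mul_exp s b hb hmean] at h
  rw [intervalIntegral.integral_const_mul, Polynomial.coeff_map] at h
  have hcont : Continuous fun θ : ℝ => ∏ i ∈ s, bernoulliChar (b i / (1 + b i)) θ := by
    unfold bernoulliChar
    fun_prop
  have h2 : (∏ i ∈ s, (1 + b i)) *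
      ∫ θ in (-Real.pi)..Real.pi, (∏ i ∈ s, bernoulliChar (b i / (1 + b i)) θ).re =
      2 * Real.pi * (linProd s b).coeff r := by
    have h3 := congrArg Complex.re h
    rw [re_ofReal_mul] at h3
    have h4 : (∫ θ in (-Real.pi)..Real.pi, ∏ i ∈ s, bernoulliChar (b i / (1 + b i)) θ).re =
        ∫ θ in (-Real.pi)..Real.pi, (∏ i ∈ s, bernoulliChar (b i / (1 + b i)) θ).re := by
      have := reCLM.intervalIntegral_comp_comm
        (hcont.intervalIntegrable (μ := MeasureTheory.volume) (-Real.pi) Real.pi)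
      simpa using this.symm
    rw [h4] at h3
    rw [h3]
    have : (2 * (Real.pi : ℂ) * (algebraMap ℝ ℂ) ((linProd s b).coeff r)) =
        ((2 * Real.pi * (linProd s b).coeff r : ℝ) : ℂ) := by
      push_cast
      rfl
    rw [this, ofReal_re]
  have hP : 0 < ∏ i ∈ s, (1 + b i) := Finset.prod_pos fun i hi => by linarith [hb i hi]
  have hpi := Real.pi_pos
  rw [normalizedCoeff, div_eq_iff hP.ne', mul_assoc,
    mul_comm (∫ θ in (-Real.pi)..Real.pi, _), h2]
  field_simp

/-- Local central limit theorem, with a quantitative error, for a sum of independent Bernoulli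
variables at an integral mean. -/
theorem abs_normalizedCoeff_sub_le (s : Finset ι) (b : ι → ℝ) (hb : ∀ i ∈ s, 0 ≤ b i) {r : ℕ}
    (hmean : ∑ i ∈ s, b i / (1 + b i) = r) {V : ℝ}
    (hV : V = ∑ i ∈ s, b i / (1 + b i) ^ 2) (hV0 : 0 < V) :
    |normalizedCoeff s b r - 1 / √(2 * Real.pi)| ≤ 1200 / V := by
  have hpi := Real.pi_pos
  have hV' : V = ∑ i ∈ s, b i / (1 + b i) * (1 - b i / (1 + b i)) := by
    rw [hV]
    refine Finset.sum_congr rfl fun i hi => ?_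
    have : 1 + b i ≠ 0 := by linarith [hb i hi]
    field_simp
    ring
  have hpt := abs_re_prod_bernoulliChar_sub_le s (fun i => b i / (1 + b i))
    (fun i hi => div_nonneg (hb i hi) (by linarith [hb i hi]))
    (fun i hi => (div_le_one (by linarith [hb i hi])).2 (by linarith)) hV' hV0
  set f : ℝ → ℝ := Set.indicator (Set.Ioc (-Real.pi) Real.pi)
        (fun θ => (∏ i ∈ s, bernoulliChar (b i / (1 + b i)) θ).re) with hf
  have hcont : Continuous fun θ : ℝ => (∏ i ∈ s, bernoulliChar (b i / (1 + b i)) θ).re := by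
    unfold bernoulliChar
    fun_prop
  have hfint : MeasureTheory.Integrable f := by
    rw [hf, MeasureTheory.integrable_indicator_iff measurableSet_Ioc]
    exact (hcont.integrableOn_Icc).mono_set Set.Ioc_subset_Icc_self
  have hgauss : ∀ c : ℝ, (fun θ : ℝ => Real.exp (-(V * θ ^ 2 / c))) =
      fun θ : ℝ => Real.exp (-(V / c) * θ ^ 2) := fun c => by
    ext θ; ring_nf
  have hgint : ∀ c : ℝ, 0 < c → MeasureTheory.Integrable
      (fun θ : ℝ => Real.exp (-(V * θ ^ 2 / c))) := fun c hc => by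
    rw [hgauss]; exact integrable_exp_neg_mul_sq (by positivity)
  have hgval : ∀ c : ℝ, ∫ θ : ℝ, Real.exp (-(V * θ ^ 2 / c)) = √(Real.pi / (V / c)) :=
    fun c => by rw [hgauss]; exact integral_gaussian _
  have hfval : ∫ θ, f θ =
      ∫ θ in (-Real.pi)..Real.pi, (∏ i ∈ s, bernoulliChar (b i / (1 + b i)) θ).re := by
    rw [hf, MeasureTheory.integral_indicator measurableSet_Ioc,
      intervalIntegral.integral_of_le (by linarith)]
  -- The pointwise bound is integrated over the line; √V/(2π) times the Gaussian integral √(2π/V) is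
  -- 1/√(2π).
  have hbound : |(∫ θ, f θ) - √(Real.pi / (V / 2))| ≤ 1200 / V * √(Real.pi / (V / 12)) := by
    rw [← hgval 2, ← hgval 12, ← MeasureTheory.integral_sub hfint (hgint 2 (by norm_num)),
      ← MeasureTheory.integral_const_mul, ← Real.norm_eq_abs]
    exact MeasureTheory.norm_integral_le_of_norm_le ((hgint 12 (by norm_num)).const_mul _)
      (Filter.Eventually.of_forall hpt)
  have hsV : 0 < √V := Real.sqrt_pos.2 hV0
  have hsplit : ∀ c : ℝ, 0 < c → √(Real.pi / (V / c)) = √(c * Real.pi) / √V := fun c hc => by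
    rw [← Real.sqrt_div (by positivity)]
    congr 1
    field_simp
  rw [hsplit 2 (by norm_num), hsplit 12 (by norm_num)] at hbound
  rw [normalizedCoeff_eq_integral s b hb hmean, ← hV, ← hfval]
  have hs2 : √(2 * Real.pi) * √(2 * Real.pi) = 2 * Real.pi := Real.mul_self_sqrt (by positivity)
  have hs2pos : 0 < √(2 * Real.pi) := Real.sqrt_pos.2 (by positivity)
  have e1 : √V / (2 * Real.pi) * (∫ θ, f θ) - 1 / √(2 * Real.pi) =
      √V / (2 * Real.pi) * ((∫ θ, f θ) - √(2 * Real.pi) / √V) := by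
    rw [mul_sub]
    congr 1
    rw [div_mul_div_comm, mul_comm √V, mul_div_mul_right _ _ hsV.ne',
      div_eq_div_iff hs2pos.ne' (by positivity), hs2, one_mul]
  have hs12 : √(12 * Real.pi) ≤ 2 * Real.pi := by
    rw [Real.sqrt_le_left (by positivity)]
    nlinarith [Real.pi_gt_three]
  rw [e1, abs_mul, abs_of_pos (by positivity)]
  calc √V / (2 * Real.pi) * |(∫ θ, f θ) - √(2 * Real.pi) / √V|
      ≤ √V / (2 * Real.pi) * (1200 / V * (√(12 * Real.pi) / √V)) := by gcongr
    _ = 1200 / V * (√(12 * Real.pi) / (2 * Real.pi)) := by field_simp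
    _ ≤ 1200 / V * 1 := by
        gcongr
        exact (div_le_one (by positivity)).2 hs12
    _ = _ := mul_one _

end FourierInversion

/-! ### The weights i + j + 1, the saddle point and the constant A -/

section MomentPolynomial

/-- The pairs `(i, j)` with `0 ≤ i, j ≤ k - 1`. -/
def indexSquare (k : ℕ) : Finset (ℕ × ℕ) := Finset.range k ×ˢ Finset.range k

/-- The number `i + j + 1` attached to a pair `(i, j)`. -/
def pairWeight (x : ℕ × ℕ) : ℝ := x.1 + x.2 + 1

theorem pairWeight_pos (x : ℕ × ℕ) : 0 < pairWeight x := by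
  unfold pairWeight; positivity

theorem pairWeight_le {k : ℕ} {x : ℕ × ℕ} (hx : x ∈ indexSquare k) : pairWeight x ≤ 2 * k := by
  simp only [indexSquare, Finset.mem_product, Finset.mem_range] at hx
  have : x.1 + x.2 + 1 ≤ 2 * k := by omega
  unfold pairWeight
  exact_mod_cast this

theorem card_indexSquare (k : ℕ) : (indexSquare k).card = k ^ 2 := by
  simp [indexSquare, sq]

/-- The value n is taken by i + j + 1 exactly n times if n ≤ k and 2k - n times if k < n ≤ 2k. -/
theorem sum_range_sum_range_add (f : ℕ → ℝ) (k : ℕ) :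
    ∑ i ∈ Finset.range k, ∑ j ∈ Finset.range k, f (i + j + 1) =
      ∑ i ∈ Finset.range k, ((i : ℝ) + 1) * f (i + 1) +
        ∑ i ∈ Finset.range k, ((k : ℝ) - 1 - i) * f (k + 1 + i) := by
  induction k with
  | zero => simp
  | succ k ih =>
    have h1 : ∑ i ∈ Finset.range (k + 1), ((k : ℝ) - i) * f (k + 2 + i) =
        ∑ i ∈ Finset.range k, ((k : ℝ) + 1 - i) * f (k + 1 + i) + f (2 * k + 1) -
          (k + 1) * f (k + 1) := by
      have h2 := Finset.sum_range_succ' (fun i : ℕ => ((k : ℝ) + 1 - i) * f (k + 1 + i)) (k + 1)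
      rw [Finset.sum_range_succ, Finset.sum_range_succ] at h2
      have h3 : ∀ i : ℕ, ((k : ℝ) + 1 - ((i + 1 : ℕ) : ℝ)) * f (k + 1 + (i + 1)) =
          ((k : ℝ) - i) * f (k + 2 + i) := by
        intro i
        rw [show k + 1 + (i + 1) = k + 2 + i by ring]
        push_cast
        ring
      simp only [h3] at h2
      rw [show k + 1 + k = 2 * k + 1 by ring] at h2
      push_cast at h2
      simp only [add_zero] at h2
      linarith
    have h4 : ∑ i ∈ Finset.range k, ((k : ℝ) + 1 - i) * f (k + 1 + i) =
        ∑ i ∈ Finset.range k, ((k : ℝ) - 1 - i) * f (k + 1 + i) +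
          2 * ∑ i ∈ Finset.range k, f (k + 1 + i) := by
      rw [Finset.mul_sum, ← Finset.sum_add_distrib]
      exact Finset.sum_congr rfl fun i _ => by ring
    have h5 : ∑ i ∈ Finset.range k, f (i + k + 1) = ∑ i ∈ Finset.range k, f (k + 1 + i) :=
      Finset.sum_congr rfl fun i _ => by congr 1; ring
    have h6 : ∑ i ∈ Finset.range k, f (k + i + 1) = ∑ i ∈ Finset.range k, f (k + 1 + i) :=
      Finset.sum_congr rfl fun i _ => by congr 1; ring
    have h7 : ∑ i ∈ Finset.range (k + 1), (((k + 1 : ℕ) : ℝ) - 1 - i) * f (k + 1 + 1 + i) =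
        ∑ i ∈ Finset.range (k + 1), ((k : ℝ) - i) * f (k + 2 + i) :=
      Finset.sum_congr rfl fun i _ => by push_cast; ring_nf
    rw [h7, h1, h4, Finset.sum_range_succ]
    simp only [Finset.sum_range_succ _ k]
    rw [Finset.sum_add_distrib, ih, h5, h6, show k + k + 1 = 2 * k + 1 by ring]
    ring

/-- Summation over the multiset of the numbers `i + j + 1`. -/
theorem sum_indexSquare (f : ℝ → ℝ) (k : ℕ) :
    ∑ x ∈ indexSquare k, f (pairWeight x) =
      ∑ j ∈ Finset.Icc 1 k, (j : ℝ) * f j +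
        ∑ j ∈ Finset.Icc (k + 1) (2 * k), (2 * (k : ℝ) - j) * f j := by
  have h := sum_range_sum_range_add (fun n => f n) k
  have e1 : Finset.Icc 1 k = Finset.Ico 1 (k + 1) := by ext; simp
  have e2 : Finset.Icc (k + 1) (2 * k) = Finset.Ico (k + 1) (2 * k + 1) := by
    ext; simp
  rw [e1, e2, Finset.sum_Ico_eq_sum_range, Finset.sum_Ico_eq_sum_range,
    show 2 * k + 1 - (k + 1) = k by omega, Nat.add_sub_cancel, indexSquare, Finset.sum_product]
  simp only [pairWeight]
  push_cast at h ⊢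
  rw [h]
  congr 1
  · exact Finset.sum_congr rfl fun i _ => by rw [add_comm (1 : ℝ)]
  · exact Finset.sum_congr rfl fun i _ => by ring

theorem momentPoly_eq_linProd (k : ℕ) :
    momentPoly k = linProd (indexSquare k) fun x => (pairWeight x)⁻¹ := by
  simp only [momentPoly, linProd, indexSquare, Finset.prod_product, pairWeight, one_div]

theorem saddleLHS_eq_sum (k : ℕ) (u : ℝ) :
    saddleLHS k u = ∑ x ∈ indexSquare k, u / (u + pairWeight x) := by
  rw [sum_indexSquare (fun m => u / (u + m)), saddleLHS, Finset.mul_sum, Finset.mul_sum]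
  congr 1 <;> exact Finset.sum_congr rfl fun i _ => by ring

theorem saddleLHS_eq_mean (k : ℕ) {u : ℝ} (hu : 0 < u) :
    saddleLHS k u = ∑ x ∈ indexSquare k,
      (pairWeight x)⁻¹ * u / (1 + (pairWeight x)⁻¹ * u) := by
  rw [saddleLHS_eq_sum]
  refine Finset.sum_congr rfl fun x _ => ?_
  have := pairWeight_pos x
  field_simp
  ring

theorem saddleU_eq_sum (k : ℕ) (u : ℝ) :
    saddleU k u = ∑ x ∈ indexSquare k, u * pairWeight x / (u + pairWeight x) ^ 2 := by
  rw [sum_indexSquare (fun m => u * m / (u + m) ^ 2), saddleU, Finset.mul_sum, Finset.mul_sum]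
  congr 1 <;> exact Finset.sum_congr rfl fun i _ => by ring

theorem saddleU_eq_variance (k : ℕ) {u : ℝ} (hu : 0 < u) :
    saddleU k u = ∑ x ∈ indexSquare k,
      (pairWeight x)⁻¹ * u / (1 + (pairWeight x)⁻¹ * u) ^ 2 := by
  rw [saddleU_eq_sum]
  refine Finset.sum_congr rfl fun x _ => ?_
  have := pairWeight_pos x
  field_simp
  ring

theorem sum_pairWeight (k : ℕ) : ∑ x ∈ indexSquare k, pairWeight x = (k : ℝ) ^ 3 := by
  have h : ∑ i ∈ Finset.range k, (i : ℝ) = k * (k - 1) / 2 := by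
    induction k with
    | zero => simp
    | succ k ih => rw [Finset.sum_range_succ, ih]; push_cast; ring
  simp only [indexSquare, Finset.sum_product, pairWeight, Finset.sum_add_distrib,
    Finset.sum_const, Finset.card_product, Finset.card_range, nsmul_eq_mul, ← Finset.mul_sum, h]
  push_cast
  ring

theorem sum_pairWeight_sq_le (k : ℕ) :
    ∑ x ∈ indexSquare k, pairWeight x ^ 2 ≤ 2 * (k : ℝ) ^ 4 := by
  calc ∑ x ∈ indexSquare k, pairWeight x ^ 2
      ≤ ∑ x ∈ indexSquare k, 2 * k * pairWeight x := by
        refine Finset.sum_le_sum fun x hx => ?_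
        rw [sq]
        exact mul_le_mul_of_nonneg_right (pairWeight_le hx) (pairWeight_pos x).le
    _ = 2 * (k : ℝ) ^ 4 := by rw [← Finset.mul_sum, sum_pairWeight]; ring

theorem sum_inv_pairWeight (k : ℕ) :
    ∑ x ∈ indexSquare k, (pairWeight x)⁻¹ = k * harmonicA k := by
  rw [sum_indexSquare (fun m => m⁻¹), harmonicA]
  have h1 : ∑ j ∈ Finset.Icc 1 k, (j : ℝ) * (j : ℝ)⁻¹ = k := by
    rw [Finset.sum_congr rfl (g := fun _ => (1 : ℝ))]
    · simp
    · intro j hj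
      have : (j : ℝ) ≠ 0 := by
        have := (Finset.mem_Icc.1 hj).1
        positivity
      field_simp
  have h2 : ∑ j ∈ Finset.Icc (k + 1) (2 * k), (2 * (k : ℝ) - j) * (j : ℝ)⁻¹ =
      2 * k * ∑ j ∈ Finset.Icc (k + 1) (2 * k), 1 / (j : ℝ) - k := by
    have h3 : ∑ j ∈ Finset.Icc (k + 1) (2 * k), (1 : ℝ) = k := by
      simp only [Finset.sum_const, Nat.card_Icc, nsmul_eq_mul, mul_one]
      congr 1
      omega
    have h4 : ∀ j ∈ Finset.Icc (k + 1) (2 * k),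
        (2 * (k : ℝ) - j) * (j : ℝ)⁻¹ = 2 * k * (1 / (j : ℝ)) - 1 := by
      intro j hj
      have : (j : ℝ) ≠ 0 := by
        have := (Finset.mem_Icc.1 hj).1
        have : 0 < j := by omega
        positivity
      field_simp
    rw [Finset.sum_congr rfl h4, Finset.sum_sub_distrib, ← Finset.mul_sum, h3]
  rw [h1, h2]
  ring

theorem one_le_harmonicA {k : ℕ} (hk : 0 < k) : 1 ≤ harmonicA k := by
  have hk' : (0 : ℝ) < k := by exact_mod_cast hk
  have h1 : ∑ j ∈ Finset.Icc (k + 1) (2 * k), 1 / (2 * (k : ℝ)) ≤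
      ∑ j ∈ Finset.Icc (k + 1) (2 * k), 1 / (j : ℝ) := by
    refine Finset.sum_le_sum fun j hj => ?_
    obtain ⟨ha, hb⟩ := Finset.mem_Icc.1 hj
    have h0 : (0 : ℝ) < j := by
      have : 0 < j := by omega
      exact_mod_cast this
    have h2 : (j : ℝ) ≤ 2 * k := by exact_mod_cast hb
    gcongr
  rw [Finset.sum_const, Nat.card_Icc, show 2 * k + 1 - (k + 1) = k by omega, nsmul_eq_mul] at h1
  have h2 : (k : ℝ) * (1 / (2 * k)) = 1 / 2 := by field_simp
  rw [harmonicA]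
  linarith

theorem harmonicA_le_two {k : ℕ} (hk : 0 < k) : harmonicA k ≤ 2 := by
  have hk' : (0 : ℝ) < k := by exact_mod_cast hk
  have h1 : ∑ j ∈ Finset.Icc (k + 1) (2 * k), 1 / (j : ℝ) ≤
      ∑ j ∈ Finset.Icc (k + 1) (2 * k), 1 / (k : ℝ) := by
    refine Finset.sum_le_sum fun j hj => ?_
    obtain ⟨ha, hb⟩ := Finset.mem_Icc.1 hj
    have h2 : (k : ℝ) ≤ j := by
      have : k ≤ j := by omega
      exact_mod_cast this
    gcongr
  rw [Finset.sum_const, Nat.card_Icc, show 2 * k + 1 - (k + 1) = k by omega, nsmul_eq_mul] at h1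
  have h2 : (k : ℝ) * (1 / k) = 1 := by field_simp
  rw [harmonicA]
  linarith

/-- Each value m has multiplicity at most m, so the sum is bounded by the harmonic number of 2k. -/
theorem sum_inv_pairWeight_sq_le (k : ℕ) :
    ∑ x ∈ indexSquare k, (pairWeight x)⁻¹ ^ 2 ≤ 1 + Real.log (2 * k) := by
  have h := harmonic_le_one_add_log (2 * k)
  push_cast at h
  refine le_trans ?_ h
  rw [sum_indexSquare (fun m => m⁻¹ ^ 2), harmonic_eq_sum_Icc]
  push_cast
  have h1 : Finset.Icc 1 (2 * k) = Finset.Icc 1 k ∪ Finset.Icc (k + 1) (2 * k) := by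
    ext; simp only [Finset.mem_union, Finset.mem_Icc]; omega
  rw [h1, Finset.sum_union (Finset.disjoint_left.2 fun a ha hb => by
    simp only [Finset.mem_Icc] at ha hb; omega)]
  refine add_le_add (Finset.sum_le_sum fun j hj => ?_) (Finset.sum_le_sum fun j hj => ?_)
  · have : (0 : ℝ) < j := by
      have := (Finset.mem_Icc.1 hj).1
      positivity
    rw [sq, mul_inv_cancel_left₀ this.ne']
  · obtain ⟨ha, hb⟩ := Finset.mem_Icc.1 hj
    have h2 : (k : ℝ) ≤ j := by
      have : k ≤ j := by omega
      exact_mod_cast this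
    have h0 : (0 : ℝ) < j := by
      have : 0 < j := by omega
      exact_mod_cast this
    have h3 : (2 * (k : ℝ) - j) ≤ j := by linarith
    calc (2 * (k : ℝ) - j) * (j : ℝ)⁻¹ ^ 2 ≤ j * (j : ℝ)⁻¹ ^ 2 := by gcongr
      _ = (j : ℝ)⁻¹ := by rw [sq, mul_inv_cancel_left₀ h0.ne']

theorem existsUnique_isSaddle {k r : ℕ} (hr : 0 < r) (hrk : r < k ^ 2) :
    ∃! u : ℝ, IsSaddle k r u := by
  have hk : 0 < k := by
    rcases Nat.eq_zero_or_pos k with rfl | h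
    · simp at hrk
    · exact h
  have hk' : (0 : ℝ) < k := by exact_mod_cast hk
  have hr' : (1 : ℝ) ≤ r := by exact_mod_cast hr
  have hrk' : (r : ℝ) < (k : ℝ) ^ 2 := by exact_mod_cast hrk
  have hcont : ContinuousOn (saddleLHS k) (Set.Icc 0 ((k : ℝ) ^ 3)) := by
    have : saddleLHS k = fun u => ∑ x ∈ indexSquare k, u / (u + pairWeight x) :=
      funext (saddleLHS_eq_sum k)
    rw [this]
    refine continuousOn_finsetSum _ fun x _ => ContinuousOn.div (by fun_prop) (by fun_prop) ?_
    intro u hu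
    linarith [pairWeight_pos x, hu.1]
  have h0 : saddleLHS k 0 = 0 := by simp [saddleLHS]
  -- The point k³ suffices: u/(u + m) ≥ 1 - m/u, and the weights m sum to k³.
  have h1 : (k : ℝ) ^ 2 - 1 ≤ saddleLHS k ((k : ℝ) ^ 3) := by
    have h2 : (k : ℝ) ^ 2 - 1 = ∑ x ∈ indexSquare k, (1 - pairWeight x / (k : ℝ) ^ 3) := by
      rw [Finset.sum_sub_distrib, ← Finset.sum_div, sum_pairWeight, Finset.sum_const,
        card_indexSquare, div_self (by positivity)]
      simp
    rw [h2, saddleLHS_eq_sum]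
    refine Finset.sum_le_sum fun x _ => ?_
    have := pairWeight_pos x
    have hk3 : (0 : ℝ) < (k : ℝ) ^ 3 := by positivity
    rw [le_div_iff₀ (by positivity)]
    have : (1 - pairWeight x / (k : ℝ) ^ 3) * ((k : ℝ) ^ 3 + pairWeight x) =
        (k : ℝ) ^ 3 - pairWeight x ^ 2 / (k : ℝ) ^ 3 := by
      field_simp
      ring
    rw [this]
    have : 0 ≤ pairWeight x ^ 2 / (k : ℝ) ^ 3 := by positivity
    linarith
  obtain ⟨u, hu, huv⟩ := intermediate_value_Icc (by positivity : (0 : ℝ) ≤ (k : ℝ) ^ 3) hcont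
    (show (k : ℝ) ^ 2 - r ∈ Set.Icc _ _ from ⟨by rw [h0]; linarith, by linarith⟩)
  have hupos : 0 < u := by
    refine lt_of_le_of_ne hu.1 fun h => ?_
    rw [← h, h0] at huv
    linarith
  have hmono : ∀ a b : ℝ, 0 < a → a < b → saddleLHS k a < saddleLHS k b := by
    intro a b ha hab
    rw [saddleLHS_eq_sum, saddleLHS_eq_sum]
    refine Finset.sum_lt_sum_of_nonempty ⟨(0, 0), by simp [indexSquare, hk]⟩ fun x _ => ?_
    have := pairWeight_pos x
    rw [div_lt_div_iff₀ (by linarith) (by linarith)]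
    nlinarith
  refine ⟨u, ⟨hupos, huv⟩, fun v ⟨hv, hvv⟩ => ?_⟩
  rcases lt_trichotomy v u with h | h | h
  · have := hmono v u hv h; linarith
  · exact h
  · have := hmono u v hupos h; linarith

/-- The variance at the saddle point is comparable with the smaller of `r` and `k² - r`. -/
theorem min_le_saddleU {k r : ℕ} (hk : 0 < k) {u : ℝ} (hu : IsSaddle k r u) :
    min (r : ℝ) ((k : ℝ) ^ 2 - r) / 36 ≤ saddleU k u := by
  obtain ⟨hu0, hu⟩ := hu
  have hk' : (0 : ℝ) < k := by exact_mod_cast hk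
  rw [saddleLHS_eq_sum] at hu
  rw [saddleU_eq_sum]
  -- If u ≤ k, then u + m ≤ 3k gives U ≥ uk/9, while k² - r ≤ 2uk. If u ≥ k, then u/(u + m) ≥ 1/3
  -- gives U ≥ r/3.
  rcases le_total u k with h | h
  · have h1 : u * k / 9 ≤ ∑ x ∈ indexSquare k, u * pairWeight x / (u + pairWeight x) ^ 2 := by
      have h2 : u * k / 9 = ∑ x ∈ indexSquare k, u * pairWeight x / (3 * k) ^ 2 := by
        rw [← Finset.sum_div, ← Finset.mul_sum, sum_pairWeight]
        field_simp
        norm_num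
      rw [h2]
      refine Finset.sum_le_sum fun x hx => ?_
      have := pairWeight_pos x
      have := pairWeight_le hx
      gcongr
      linarith
    have h3 : (k : ℝ) ^ 2 - r ≤ u * (k * harmonicA k) := by
      rw [← hu, ← sum_inv_pairWeight, Finset.mul_sum]
      refine Finset.sum_le_sum fun x _ => ?_
      have := pairWeight_pos x
      rw [← div_eq_mul_inv]
      gcongr
      linarith
    have h4 : u * (k * harmonicA k) ≤ u * (k * 2) := by
      have := harmonicA_le_two hk
      gcongr
    have h5 := min_le_right (r : ℝ) ((k : ℝ) ^ 2 - r)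
    have h6 : 0 < u * k := by positivity
    linarith
  · have h1 : (r : ℝ) = ∑ x ∈ indexSquare k, pairWeight x / (u + pairWeight x) := by
      have h2 : (k : ℝ) ^ 2 = ∑ x ∈ indexSquare k, (1 : ℝ) := by
        simp [card_indexSquare]
      have h3 : (r : ℝ) = (k : ℝ) ^ 2 - ((k : ℝ) ^ 2 - r) := by ring
      rw [h3, ← hu, h2, ← Finset.sum_sub_distrib]
      refine Finset.sum_congr rfl fun x _ => ?_
      have := pairWeight_pos x
      field_simp
      ring
    have h2 : (r : ℝ) / 3 ≤ ∑ x ∈ indexSquare k, u * pairWeight x / (u + pairWeight x) ^ 2 := by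
      rw [h1, Finset.sum_div]
      refine Finset.sum_le_sum fun x hx => ?_
      have h3 := pairWeight_pos x
      have h4 := pairWeight_le hx
      have h5 : u * pairWeight x / (u + pairWeight x) ^ 2 =
          pairWeight x / (u + pairWeight x) * (u / (u + pairWeight x)) := by
        field_simp
      have h6 : 1 / 3 ≤ u / (u + pairWeight x) := by
        rw [div_le_div_iff₀ (by norm_num) (by linarith)]
        linarith
      rw [h5, div_eq_mul_one_div _ (3 : ℝ)]
      gcongr
    have h5 := min_le_left (r : ℝ) ((k : ℝ) ^ 2 - r)
    have h6 : (0 : ℝ) ≤ r := by positivity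
    linarith

theorem harmonicA_eq_harmonic (k : ℕ) :
    harmonicA k = 2 * ((harmonic (2 * k) : ℝ) - (harmonic k : ℝ)) := by
  have h1 : Finset.Icc 1 (2 * k) = Finset.Icc 1 k ∪ Finset.Icc (k + 1) (2 * k) := by
    ext; simp only [Finset.mem_union, Finset.mem_Icc]; omega
  rw [harmonicA, harmonic_eq_sum_Icc, harmonic_eq_sum_Icc, h1,
    Finset.sum_union (Finset.disjoint_left.2 fun a ha hb => by
      simp only [Finset.mem_Icc] at ha hb; omega)]
  push_cast
  simp only [one_div, add_sub_cancel_left]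

theorem tendsto_harmonicA : Filter.Tendsto harmonicA Filter.atTop (nhds (Real.log 4)) := by
  have h1 := Real.tendsto_harmonic_sub_log
  have h2 := h1.comp (Filter.tendsto_id.const_mul_atTop' (show 0 < 2 by norm_num))
  have h3 := ((h2.sub h1).const_mul 2).add_const (2 * Real.log 2)
  have h4 : Real.log 4 = 2 * Real.log 2 := by
    rw [show (4 : ℝ) = 2 ^ 2 by norm_num, Real.log_pow]; norm_num
  rw [sub_self, mul_zero, zero_add, ← h4] at h3
  refine h3.congr' ?_
  filter_upwards [Filter.eventually_gt_atTop 0] with k hk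
  have hk' : (k : ℝ) ≠ 0 := by positivity
  rw [harmonicA_eq_harmonic]
  simp only [Function.comp, id]
  push_cast
  rw [Real.log_mul two_ne_zero hk', h4]
  ring

theorem harmonicA_succ (k : ℕ) :
    harmonicA (k + 1) = harmonicA k + 1 / ((2 * k + 1) * (k + 1)) := by
  rw [harmonicA_eq_harmonic, harmonicA_eq_harmonic, show 2 * (k + 1) = 2 * k + 1 + 1 by ring,
    harmonic_succ, harmonic_succ, harmonic_succ]
  push_cast
  have : (2 * (k : ℝ) + 1) ≠ 0 := by positivity
  have : ((k : ℝ) + 1) ≠ 0 := by positivity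
  have : (2 * (k : ℝ) + 1 + 1) ≠ 0 := by positivity
  field_simp
  ring

/-- The sequences A_n + 1/(2n) and A_n + 1/(2n) - 1/n² are respectively decreasing and increasing,
and both tend to log 4. -/
theorem abs_harmonicA_sub_le {k : ℕ} (hk : 1 ≤ k) :
    |harmonicA k - (Real.log 4 - 1 / (2 * (k : ℝ)))| ≤ 1 / (k : ℝ) ^ 2 := by
  have hlim1 : Filter.Tendsto (fun n : ℕ => harmonicA n + 1 / (2 * (n : ℝ))) Filter.atTop
      (nhds (Real.log 4)) := by
    have h := tendsto_harmonicA.add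
      ((tendsto_one_div_atTop_nhds_zero_nat (𝕜 := ℝ)).const_mul (1 / 2))
    rw [mul_zero, add_zero] at h
    refine h.congr fun n => ?_
    rw [one_div_mul_one_div]
  have hlim2 : Filter.Tendsto (fun n : ℕ => harmonicA n + 1 / (2 * (n : ℝ)) - 1 / (n : ℝ) ^ 2)
      Filter.atTop (nhds (Real.log 4)) := by
    have h := hlim1.sub ((tendsto_one_div_atTop_nhds_zero_nat (𝕜 := ℝ)).pow 2)
    simpa using h
  have hanti : ∀ n ≥ k, harmonicA (n + 1) + 1 / (2 * ((n + 1 : ℕ) : ℝ)) ≤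
      harmonicA n + 1 / (2 * (n : ℝ)) := by
    intro n hn
    have hn' : (0 : ℝ) < n := by
      have : 0 < n := by omega
      exact_mod_cast this
    rw [harmonicA_succ]
    push_cast
    have : 1 / (2 * (n : ℝ)) - 1 / ((2 * n + 1) * (n + 1)) - 1 / (2 * ((n : ℝ) + 1)) =
        1 / (2 * n * (n + 1) * (2 * n + 1)) := by
      field_simp
      ring
    have : 0 ≤ 1 / (2 * (n : ℝ) * (n + 1) * (2 * n + 1)) := by positivity
    linarith
  have hmono : ∀ n ≥ k, harmonicA n + 1 / (2 * (n : ℝ)) - 1 / (n : ℝ) ^ 2 ≤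
      harmonicA (n + 1) + 1 / (2 * ((n + 1 : ℕ) : ℝ)) - 1 / ((n + 1 : ℕ) : ℝ) ^ 2 := by
    intro n hn
    have hn' : (0 : ℝ) < n := by
      have : 0 < n := by omega
      exact_mod_cast this
    rw [harmonicA_succ]
    push_cast
    have h1 : 1 / (2 * (n : ℝ)) - 1 / ((2 * n + 1) * (n + 1)) - 1 / (2 * ((n : ℝ) + 1)) =
        1 / (2 * n * (n + 1) * (2 * n + 1)) := by
      field_simp
      ring
    have h2 : 1 / (n : ℝ) ^ 2 - 1 / ((n : ℝ) + 1) ^ 2 = (2 * n + 1) / (n ^ 2 * (n + 1) ^ 2) := by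
      field_simp
      ring
    have h3 : 1 / (2 * (n : ℝ) * (n + 1) * (2 * n + 1)) ≤
        (2 * n + 1) / ((n : ℝ) ^ 2 * (n + 1) ^ 2) := by
      rw [div_le_div_iff₀ (by positivity) (by positivity)]
      have : 0 ≤ (n : ℝ) * (n + 1) := by positivity
      nlinarith [mul_nonneg this this, mul_nonneg this hn'.le, mul_nonneg (mul_nonneg this this) hn'.le,
        mul_nonneg (mul_nonneg this hn'.le) hn'.le]
    linarith
  have hle : Real.log 4 ≤ harmonicA k + 1 / (2 * (k : ℝ)) := by
    refine le_of_tendsto hlim1 ?_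
    filter_upwards [Filter.eventually_ge_atTop k] with n hn
    induction n, hn using Nat.le_induction with
    | base => exact le_rfl
    | succ n hn ih => exact (hanti n hn).trans ih
  have hge : harmonicA k + 1 / (2 * (k : ℝ)) - 1 / (k : ℝ) ^ 2 ≤ Real.log 4 := by
    refine ge_of_tendsto hlim2 ?_
    filter_upwards [Filter.eventually_ge_atTop k] with n hn
    induction n, hn using Nat.le_induction with
    | base => exact le_rfl
    | succ n hn ih => exact ih.trans (hmono n hn)
  rw [abs_le]
  have : 0 ≤ 1 / (k : ℝ) ^ 2 := by positivity
  constructor <;> linarith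

end MomentPolynomial

/-! ### Relative errors, extreme coefficients and comparison of two Bernoulli sums -/

section Asymptotics

theorem exists_relative_error_linProd_coeff {ι : Type*} (s : Finset ι) (b : ι → ℝ)
    (hb : ∀ i ∈ s, 0 ≤ b i) (hS : 0 < ∑ i ∈ s, b i) (r : ℕ) :
    ∃ ε : ℝ, |ε| ≤ r ^ 2 * (∑ i ∈ s, b i ^ 2) / (∑ i ∈ s, b i) ^ 2 / 2 ∧
      (linProd s b).coeff r = (∑ i ∈ s, b i) ^ r / r.factorial * (1 + ε) := by
  have h1 := factorial_mul_linProd_coeff_le s b hb r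
  have h2 := le_factorial_mul_linProd_coeff s b hb r
  have hT : 0 ≤ ∑ i ∈ s, b i ^ 2 := Finset.sum_nonneg fun _ _ => sq_nonneg _
  set S := ∑ i ∈ s, b i
  set T := ∑ i ∈ s, b i ^ 2
  have hf : (0 : ℝ) < r.factorial := by positivity
  have hSr : 0 < S ^ r := by positivity
  refine ⟨r.factorial * (linProd s b).coeff r / S ^ r - 1, ?_, by field_simp; ring⟩
  have h3 : (r : ℝ) * (r - 1) / 2 * T * S ^ (r - 2) ≤ r ^ 2 * T / S ^ 2 / 2 * S ^ r := by
    rcases r with _ | _ | r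
    · simp
    · simp; positivity
    · rw [show r + 1 + 1 - 2 = r by omega, show S ^ (r + 1 + 1) = S ^ 2 * S ^ r by ring]
      have : ((r + 1 + 1 : ℕ) : ℝ) ^ 2 * T / S ^ 2 / 2 * (S ^ 2 * S ^ r) =
          ((r + 1 + 1 : ℕ) : ℝ) ^ 2 / 2 * T * S ^ r := by field_simp
      rw [this]
      gcongr
      have : (0 : ℝ) ≤ ((r + 1 + 1 : ℕ) : ℝ) := by positivity
      nlinarith
  rw [abs_le]
  constructor
  · rw [neg_le_sub_iff_le_add, ← sub_le_iff_le_add, le_div_iff₀ hSr]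
    linarith
  · have : r.factorial * (linProd s b).coeff r / S ^ r ≤ 1 := (div_le_one hSr).2 h1
    have : 0 ≤ r ^ 2 * T / S ^ 2 / 2 := by positivity
    linarith

theorem exists_ratio_error {ε₁ ε₂ δ₁ δ₂ : ℝ} (h₁ : |ε₁| ≤ δ₁) (h₂ : |ε₂| ≤ δ₂) (hδ : δ₂ ≤ 1 / 2) :
    ∃ ε : ℝ, |ε| ≤ 2 * (δ₁ + δ₂) ∧ 1 + ε₁ = (1 + ε₂) * (1 + ε) := by
  have h3 := (abs_le.1 (h₂.trans hδ)).1
  have h4 : 0 < 1 + ε₂ := by linarith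
  refine ⟨(ε₁ - ε₂) / (1 + ε₂), ?_, by field_simp; ring⟩
  rw [abs_div, abs_of_pos h4, div_le_iff₀ h4]
  have h5 := abs_sub ε₁ ε₂
  nlinarith [abs_nonneg ε₁, abs_nonneg ε₂]

theorem exists_error_of_abs_sub_le {x y h δ : ℝ} (hh : 0 < h) (hx : |x - h| ≤ δ * h)
    (hy : |y - h| ≤ δ * h) (hδ : δ ≤ 1 / 2) : ∃ ε : ℝ, |ε| ≤ 4 * δ ∧ x = y * (1 + ε) := by
  have key : ∀ z : ℝ, |z - h| ≤ δ * h → |z / h - 1| ≤ δ := fun z hz => by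
    rw [div_sub_one hh.ne', abs_div, abs_of_pos hh, div_le_iff₀ hh]
    exact hz
  obtain ⟨ε, h1, h2⟩ := exists_ratio_error (key x hx) (key y hy) hδ
  refine ⟨ε, by linarith, ?_⟩
  rw [add_sub_cancel, add_sub_cancel] at h2
  field_simp at h2
  exact h2

/-- The binomial coefficient is the elementary symmetric function of k² ones, so the general
estimate applies. For r ≤ k its error is at most 1/2, which allows division by it. -/
theorem exists_relative_error_choose {k r : ℕ} (hk : 0 < k) (hr : r ≤ k) :
    ∃ ε : ℝ, |ε| ≤ (r : ℝ) ^ 2 / k ^ 2 / 2 ∧ (r : ℝ) ^ 2 / k ^ 2 / 2 ≤ 1 / 2 ∧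
      ((k ^ 2).choose r : ℝ) = (k : ℝ) ^ (2 * r) / r.factorial * (1 + ε) := by
  have hk' : (0 : ℝ) < k := by exact_mod_cast hk
  have hr' : (r : ℝ) ≤ k := by exact_mod_cast hr
  have hS : ∑ i ∈ indexSquare k, (1 : ℝ) = (k : ℝ) ^ 2 := by simp [card_indexSquare]
  obtain ⟨ε, h1, h2⟩ := exists_relative_error_linProd_coeff (indexSquare k) (fun _ => 1)
    (fun _ _ => zero_le_one) (by rw [hS]; positivity) r
  rw [linProd_const_coeff, card_indexSquare, one_pow, mul_one, hS, ← pow_mul] at h2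
  simp only [one_pow, hS] at h1
  refine ⟨ε, ?_, ?_, h2⟩
  · have e : (r : ℝ) ^ 2 * k ^ 2 / (k ^ 2) ^ 2 / 2 = (r : ℝ) ^ 2 / k ^ 2 / 2 := by field_simp
    rwa [e] at h1
  · have : (r : ℝ) ^ 2 / k ^ 2 ≤ 1 := by
      rw [div_le_one (by positivity)]
      gcongr
    linarith

/-- Reversal turns symmetric functions of the inverses into those of the weights themselves, and c_0
is the product of the inverses. -/
theorem momentCoeff_div_momentCoeff_zero {k r : ℕ} (hr : r ≤ k ^ 2) :
    momentCoeff k r / momentCoeff k 0 = (linProd (indexSquare k) pairWeight).coeff r := by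
  have hne : ∀ x ∈ indexSquare k, pairWeight x ≠ 0 := fun x _ => (pairWeight_pos x).ne'
  have h1 := linProd_inv_coeff_sub (indexSquare k) pairWeight hne (r := r)
    (by rwa [card_indexSquare])
  have h2 := linProd_inv_coeff_sub (indexSquare k) pairWeight hne (r := 0) (Nat.zero_le _)
  rw [linProd_coeff_zero] at h2
  rw [card_indexSquare, ← momentPoly_eq_linProd] at h1 h2
  rw [momentCoeff, momentCoeff, h1]
  rw [Nat.sub_zero] at h2 ⊢
  have h3 : (momentPoly k).coeff (k ^ 2) ≠ 0 := fun h => by simp [h] at h2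
  rw [div_eq_iff h3]
  linear_combination (momentPoly k).coeff (k ^ 2 - r) * h2

theorem leading_coefficients {k r : ℕ} (hk : 0 < k) (hr : r ≤ k) :
    (∃ ε : ℝ, |ε| ≤ 3 * ((r : ℝ) ^ 2 / k ^ 2) ∧
      momentCoeff k r / momentCoeff k 0 = (k : ℝ) ^ (3 * r) / r.factorial * (1 + ε)) ∧
    (∃ ε : ℝ, |ε| ≤ 3 * ((r : ℝ) ^ 2 / k ^ 2) ∧
      momentCoeff k r / momentCoeff k 0 = ((k ^ 2).choose r : ℝ) * (k : ℝ) ^ r * (1 + ε)) := by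
  have hk' : (0 : ℝ) < k := by exact_mod_cast hk
  rw [momentCoeff_div_momentCoeff_zero (hr.trans (Nat.le_self_pow two_ne_zero k))]
  obtain ⟨ε₁, h1, h2⟩ := exists_relative_error_linProd_coeff (indexSquare k) pairWeight
    (fun x _ => (pairWeight_pos x).le) (by rw [sum_pairWeight]; positivity) r
  rw [sum_pairWeight] at h1 h2
  have h3 : |ε₁| ≤ (r : ℝ) ^ 2 / k ^ 2 := by
    refine h1.trans ?_
    have h4 := sum_pairWeight_sq_le k
    calc (r : ℝ) ^ 2 * (∑ x ∈ indexSquare k, pairWeight x ^ 2) / ((k : ℝ) ^ 3) ^ 2 / 2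
        ≤ (r : ℝ) ^ 2 * (2 * (k : ℝ) ^ 4) / ((k : ℝ) ^ 3) ^ 2 / 2 := by gcongr
      _ = _ := by field_simp
  have h0 : 0 ≤ (r : ℝ) ^ 2 / k ^ 2 := by positivity
  obtain ⟨ε₂, h5, h6, h7⟩ := exists_relative_error_choose hk hr
  obtain ⟨ε, h8, h9⟩ := exists_ratio_error h3 h5 h6
  refine ⟨⟨ε₁, by linarith, by rw [h2, ← pow_mul]⟩, ⟨ε, by linarith, ?_⟩⟩
  rw [h2, h9, h7]
  ring

theorem sum_inv_pairWeight_sq_le_log {k : ℕ} (hk : 1 ≤ Real.log k) :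
    ∑ x ∈ indexSquare k, (pairWeight x)⁻¹ ^ 2 ≤ 3 * Real.log k := by
  have hk' : (k : ℝ) ≠ 0 := fun h => by norm_num [h] at hk
  have h := sum_inv_pairWeight_sq_le k
  rw [Real.log_mul two_ne_zero hk'] at h
  linarith [Real.log_two_lt_d9]

theorem trailing_coefficients {k r : ℕ} (hk : 1 ≤ Real.log k) (hr : r ≤ k) :
    (∃ ε : ℝ, |ε| ≤ 4 * ((r : ℝ) ^ 2 / k ^ 2 * Real.log k) ∧
      momentCoeff k (k ^ 2 - r) = ((k : ℝ) * harmonicA k) ^ r / r.factorial * (1 + ε)) ∧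
    (∃ ε : ℝ, |ε| ≤ 4 * ((r : ℝ) ^ 2 / k ^ 2 * Real.log k) ∧
      momentCoeff k (k ^ 2 - r) =
        ((k ^ 2).choose r : ℝ) * (harmonicA k ^ r / (k : ℝ) ^ r) * (1 + ε)) := by
  have hk0 : 0 < k := Nat.pos_of_ne_zero fun h => by norm_num [h] at hk
  have hk' : (0 : ℝ) < k := by exact_mod_cast hk0
  have hA := one_le_harmonicA hk0
  have hrk : r ≤ k ^ 2 := hr.trans (Nat.le_self_pow two_ne_zero k)
  rw [momentCoeff, Nat.sub_sub_self hrk, momentPoly_eq_linProd]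
  obtain ⟨ε₁, h1, h2⟩ := exists_relative_error_linProd_coeff (indexSquare k)
    (fun x => (pairWeight x)⁻¹) (fun x _ => (inv_pos.2 (pairWeight_pos x)).le)
    (by rw [sum_inv_pairWeight]; positivity) r
  rw [sum_inv_pairWeight] at h1 h2
  have h0 : 0 ≤ (r : ℝ) ^ 2 / k ^ 2 := by positivity
  have h3 : |ε₁| ≤ 3 / 2 * ((r : ℝ) ^ 2 / k ^ 2 * Real.log k) := by
    refine h1.trans ?_
    have h4 := sum_inv_pairWeight_sq_le_log hk
    have h5 : (k : ℝ) * 1 ≤ k * harmonicA k := by gcongr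
    calc (r : ℝ) ^ 2 * (∑ x ∈ indexSquare k, (pairWeight x)⁻¹ ^ 2) / (k * harmonicA k) ^ 2 / 2
        ≤ (r : ℝ) ^ 2 * (3 * Real.log k) / (k * 1) ^ 2 / 2 := by gcongr
      _ = _ := by ring
  have h10 := mul_le_mul_of_nonneg_left hk h0
  obtain ⟨ε₂, h5, h6, h7⟩ := exists_relative_error_choose hk0 hr
  obtain ⟨ε, h8, h9⟩ := exists_ratio_error h3 h5 h6
  refine ⟨⟨ε₁, by linarith, h2⟩, ⟨ε, by linarith, ?_⟩⟩
  rw [h2, h9, h7, mul_pow]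
  field_simp
  ring

theorem sq_div_sq_le_rpow {k r : ℕ} (hk : 0 < k) {α : ℝ} (hα : α < 1)
    (hr : (r : ℝ) ≤ (k : ℝ) ^ α) :
    r ≤ k ∧ (r : ℝ) ^ 2 / k ^ 2 ≤ (k : ℝ) ^ (2 * (α - 1)) := by
  have hk' : (0 : ℝ) < k := by exact_mod_cast hk
  have hk1 : (1 : ℝ) ≤ k := by exact_mod_cast hk
  constructor
  · have : (k : ℝ) ^ α ≤ (k : ℝ) ^ (1 : ℝ) := Real.rpow_le_rpow_of_exponent_le hk1 hα.le
    rw [Real.rpow_one] at this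
    exact_mod_cast hr.trans this
  · have h1 : (k : ℝ) ^ (2 * (α - 1)) = ((k : ℝ) ^ α / k) ^ 2 := by
      rw [mul_comm, Real.rpow_mul hk'.le, Real.rpow_sub hk', Real.rpow_one]
      norm_cast
    rw [h1, ← div_pow]
    gcongr

theorem normalizedCoeff_saddle {k r : ℕ} {u : ℝ} (hu : 0 < u) :
    normalizedCoeff (indexSquare k) (fun x => (pairWeight x)⁻¹ * u) (k ^ 2 - r) =
      momentCoeff k r * u ^ (k ^ 2 - r) * √(saddleU k u) / (momentPoly k).eval u := by
  rw [normalizedCoeff, linProd_const_mul, ← momentPoly_eq_linProd, ← saddleU_eq_variance k hu,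
    momentPoly_eq_linProd, linProd_eval, ← momentPoly_eq_linProd, momentCoeff]

/-- Constant odds s/r, where s = k² - r, give the binomial law with k² trials and mean s, whose
variance is rs/k². Its normalized probability is the product of all factors not involving u. -/
theorem uniformMain_eq {k r : ℕ} (hr : 0 < r) (hrk : r < k ^ 2) (u : ℝ) :
    uniformMain k r u =
      normalizedCoeff (indexSquare k) (fun _ => ((k ^ 2 - r : ℕ) : ℝ) / r) (k ^ 2 - r) *
        ((momentPoly k).eval u / (√(saddleU k u) * u ^ (k ^ 2 - r))) := by
  obtain ⟨s, hs⟩ : ∃ s, k ^ 2 - r = s := ⟨_, rfl⟩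
  have hn : k ^ 2 = r + s := by omega
  have hs0 : 0 < s := by omega
  have hn' : (k : ℝ) ^ 2 = r + s := by exact_mod_cast hn
  have hr' : (0 : ℝ) < r := by exact_mod_cast hr
  have hs' : (0 : ℝ) < s := by exact_mod_cast hs0
  have e1 : 1 - (r : ℝ) / (r + s) = s / (r + s) := by field_simp; ring
  have e2 : (r : ℝ) + s - r + 1 / 2 = s + 1 / 2 := by ring
  have e3 : (1 : ℝ) + s / r = (r + s) / r := by field_simp
  have e4 : ((r + s : ℕ) : ℝ) * (s / r / ((r + s) / r) ^ 2) = s / (r + s) * r := by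
    push_cast
    field_simp
  have e5 : (r + s).choose s = (r + s).choose r := by
    rw [add_comm, Nat.choose_symm_add]
  have e6 : (s / r : ℝ) ^ s / ((r + s) / r) ^ (r + s) =
      (r / (r + s)) ^ r * (s / (r + s)) ^ s := by
    simp only [div_pow, pow_add]
    field_simp
  rw [uniformMain, normalizedCoeff, hs, linProd_const_coeff, Finset.sum_const, Finset.prod_const,
    card_indexSquare, hn, hn', e1, e2, e3, Real.rpow_add (by positivity), Real.rpow_natCast,
    ← Real.sqrt_eq_rpow, ← Real.sqrt_eq_rpow, nsmul_eq_mul, e4, e5,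
    Real.sqrt_mul (by positivity), mul_div_right_comm, mul_div_assoc, e6]
  ring

theorem exists_error_of_poisson_regime {ι : Type*} (s : Finset ι) (b c : ι → ℝ)
    (hb : ∀ i ∈ s, 0 ≤ b i) (hc : ∀ i ∈ s, 0 ≤ c i) {r : ℕ} (hr : 0 < r)
    (hbm : ∑ i ∈ s, b i / (1 + b i) = r) (hcm : ∑ i ∈ s, c i / (1 + c i) = r) {D : ℝ}
    (hbD : ∑ i ∈ s, b i ^ 2 ≤ D) (hcD : ∑ i ∈ s, c i ^ 2 ≤ D) (hD : D ≤ 1 / 6) :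
    ∃ ε : ℝ, |ε| ≤ 12 * D ∧ normalizedCoeff s b r = normalizedCoeff s c r * (1 + ε) := by
  have hH := poissonPeak_pos hr
  have key : ∀ a : ι → ℝ, (∀ i ∈ s, 0 ≤ a i) → ∑ i ∈ s, a i / (1 + a i) = r →
      ∑ i ∈ s, a i ^ 2 ≤ D → |normalizedCoeff s a r - poissonPeak r| ≤ 3 * D * poissonPeak r := by
    intro a ha ham haD
    have h1 := normalizedCoeff_le_poissonPeak s a ha hr ham (by linarith)
    have h2 := poissonPeak_le_normalizedCoeff s a ha hr ham (by linarith)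
    have h3 : 0 ≤ ∑ i ∈ s, a i ^ 2 := Finset.sum_nonneg fun _ _ => sq_nonneg _
    have h4 := mul_le_mul_of_nonneg_left haD hH.le
    have h5 := mul_nonneg hH.le h3
    rw [abs_le]
    constructor <;> nlinarith
  obtain ⟨ε, h1, h2⟩ :=
    exists_error_of_abs_sub_le hH (key b hb hbm hbD) (key c hc hcm hcD) (by linarith)
  exact ⟨ε, by linarith, h2⟩

theorem exists_error_of_large_variance {ι : Type*} (s : Finset ι) (b c : ι → ℝ)
    (hb : ∀ i ∈ s, 0 ≤ b i) (hc : ∀ i ∈ s, 0 ≤ c i) {r : ℕ}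
    (hbm : ∑ i ∈ s, b i / (1 + b i) = r) (hcm : ∑ i ∈ s, c i / (1 + c i) = r) {V : ℝ}
    (hV : 7200 ≤ V) (hbV : V ≤ ∑ i ∈ s, b i / (1 + b i) ^ 2)
    (hcV : V ≤ ∑ i ∈ s, c i / (1 + c i) ^ 2) :
    ∃ ε : ℝ, |ε| ≤ 14400 / V ∧ normalizedCoeff s b r = normalizedCoeff s c r * (1 + ε) := by
  have hV0 : 0 < V := by linarith
  have hs : √(2 * Real.pi) ≤ 3 := by
    rw [Real.sqrt_le_left (by norm_num)]
    nlinarith [Real.pi_lt_d2]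
  have hs0 : 0 < √(2 * Real.pi) := Real.sqrt_pos.2 (by positivity)
  have hg : 1 / 3 ≤ 1 / √(2 * Real.pi) := by gcongr
  have key : ∀ a : ι → ℝ, (∀ i ∈ s, 0 ≤ a i) → ∑ i ∈ s, a i / (1 + a i) = r →
      V ≤ ∑ i ∈ s, a i / (1 + a i) ^ 2 →
      |normalizedCoeff s a r - 1 / √(2 * Real.pi)| ≤ 3600 / V * (1 / √(2 * Real.pi)) := by
    intro a ha ham haV
    have h1 := abs_normalizedCoeff_sub_le s a ha ham rfl (by linarith)
    have h2 : 1200 / ∑ i ∈ s, a i / (1 + a i) ^ 2 ≤ 1200 / V := by gcongr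
    have h3 : 3600 / V * (1 / 3) ≤ 3600 / V * (1 / √(2 * Real.pi)) := by gcongr
    have h4 : 3600 / V * (1 / 3) = 1200 / V := by ring
    linarith
  -- The threshold 7200 makes the relative error 3600/V at most 1/2.
  obtain ⟨ε, h1, h2⟩ := exists_error_of_abs_sub_le (by positivity) (key b hb hbm hbV)
    (key c hc hcm hcV) (by rw [div_le_div_iff₀ hV0 (by norm_num)]; linarith)
  refine ⟨ε, h1.trans_eq (by ring), h2⟩

theorem const_mean {k r s : ℕ} (hr : 0 < r) (hn : k ^ 2 = r + s) :
    ∑ _x ∈ indexSquare k, ((s : ℝ) / r) / (1 + (s : ℝ) / r) = s := by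
  have hr' : (0 : ℝ) < r := by exact_mod_cast hr
  rw [Finset.sum_const, card_indexSquare, hn, nsmul_eq_mul]
  push_cast
  field_simp

theorem const_variance {k r s : ℕ} (hr : 0 < r) (hn : k ^ 2 = r + s) :
    ∑ _x ∈ indexSquare k, ((s : ℝ) / r) / (1 + (s : ℝ) / r) ^ 2 = (r : ℝ) * s / (r + s) := by
  have hr' : (0 : ℝ) < r := by exact_mod_cast hr
  rw [Finset.sum_const, card_indexSquare, hn, nsmul_eq_mul]
  push_cast
  field_simp

theorem const_sum_sq_le {k r s : ℕ} (hr : 0 < r) (hn : k ^ 2 = r + s) (hsr : s ≤ r) :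
    ∑ _x ∈ indexSquare k, ((s : ℝ) / r) ^ 2 ≤ 4 * ((s : ℝ) ^ 2 / k ^ 2) := by
  have hr' : (0 : ℝ) < r := by exact_mod_cast hr
  have hsr' : (s : ℝ) ≤ r := by exact_mod_cast hsr
  have hn' : (k : ℝ) ^ 2 = r + s := by exact_mod_cast hn
  rw [Finset.sum_const, card_indexSquare, hn, nsmul_eq_mul, hn', ← mul_div_assoc, div_pow,
    ← mul_div_assoc, div_le_div_iff₀ (by positivity) (by positivity)]
  push_cast
  have : ((r : ℝ) + s) * (r + s) ≤ (2 * r) * (2 * r) := by gcongr <;> linarith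
  nlinarith [mul_le_mul_of_nonneg_left this (sq_nonneg (s : ℝ))]

end Asymptotics

/-! ### The uniform formula in three ranges of r -/

section UniformAsymptotics

theorem inv_saddle_mean {k r : ℕ} {u : ℝ} (hu : IsSaddle k r u) :
    ∑ x ∈ indexSquare k, pairWeight x * u⁻¹ / (1 + pairWeight x * u⁻¹) = r := by
  obtain ⟨hu0, hu⟩ := hu
  rw [saddleLHS_eq_sum] at hu
  have h2 : (k : ℝ) ^ 2 = ∑ x ∈ indexSquare k, (1 : ℝ) := by simp [card_indexSquare]
  have h3 : (r : ℝ) = (k : ℝ) ^ 2 - ((k : ℝ) ^ 2 - r) := by ring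
  rw [h3, ← hu, h2, ← Finset.sum_sub_distrib]
  refine Finset.sum_congr rfl fun x _ => ?_
  have := pairWeight_pos x
  field_simp
  ring

theorem small_codegree_comparison {k r s : ℕ} {κ u : ℝ} (hL : 1 ≤ Real.log k)
    (hκ1 : 1 ≤ κ) (hκ : κ ^ 3 = (k : ℝ) ^ 2) (hη : Real.log k / κ ≤ 1 / 518400)
    (hr : 0 < r) (hs : 0 < s) (hn : k ^ 2 = r + s) (hu : IsSaddle k r u) (hsκ : (s : ℝ) ≤ κ) :
    ∃ ε : ℝ, |ε| ≤ 144 * (Real.log k / κ) ∧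
      normalizedCoeff (indexSquare k) (fun x => (pairWeight x)⁻¹ * u) s =
        normalizedCoeff (indexSquare k) (fun _ => (s : ℝ) / r) s * (1 + ε) := by
  have hκ0 : 0 < κ := by linarith
  have hk0 : 0 < k := Nat.pos_of_ne_zero fun h => by norm_num [h] at hL
  have hk' : (0 : ℝ) < k := by exact_mod_cast hk0
  have hr' : (0 : ℝ) < r := by exact_mod_cast hr
  have hn' : (k : ℝ) ^ 2 = r + s := by exact_mod_cast hn
  have hLκ : Real.log k ≤ κ / 518400 := by
    rw [div_le_iff₀ hκ0] at hη; linarith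
  have hκη : 1 / κ ≤ Real.log k / κ := by gcongr
  obtain ⟨hu0, hum⟩ := hu
  have hmean : ∑ x ∈ indexSquare k, (pairWeight x)⁻¹ * u / (1 + (pairWeight x)⁻¹ * u) = s := by
    rw [← saddleLHS_eq_mean k hu0, hum, hn']
    ring
  have hS : (k : ℝ) ^ 2 ≤ (∑ x ∈ indexSquare k, (pairWeight x)⁻¹) ^ 2 := by
    rw [sum_inv_pairWeight]
    have := one_le_harmonicA hk0
    gcongr
    nlinarith
  have hT := sum_inv_pairWeight_sq_le_log hL
  have hT0 : 0 ≤ ∑ x ∈ indexSquare k, (pairWeight x)⁻¹ ^ 2 :=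
    Finset.sum_nonneg fun _ _ => sq_nonneg _
  have hsmall : (s : ℝ) * ∑ x ∈ indexSquare k, (pairWeight x)⁻¹ ^ 2 ≤
      (∑ x ∈ indexSquare k, (pairWeight x)⁻¹) ^ 2 / 2 := by
    have h1 : (s : ℝ) * ∑ x ∈ indexSquare k, (pairWeight x)⁻¹ ^ 2 ≤ κ * (3 * (κ / 518400)) := by
      gcongr
      linarith
    have h2 : κ ^ 2 ≤ κ ^ 3 := pow_le_pow_right₀ hκ1 (by norm_num)
    nlinarith
  -- With s ≤ κ, S ≥ k and T ≤ 3 log k this yields 4κ² · 3 log k / k² = 12 log k / κ, because κ³ =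
  -- k².
  have hD := sum_sq_mul_le_of_mean (indexSquare k) (fun x => (pairWeight x)⁻¹)
    (fun x _ => inv_pos.2 (pairWeight_pos x)) hu0.le hmean hsmall
  have hD1 : ∑ x ∈ indexSquare k, ((pairWeight x)⁻¹ * u) ^ 2 ≤ 12 * (Real.log k / κ) := by
    refine hD.trans ?_
    calc _ ≤ 4 * (κ ^ 2 * (3 * Real.log k) / (k : ℝ) ^ 2) := by gcongr
      _ = _ := by rw [← hκ]; field_simp; ring
  have hsr : s ≤ r := by
    have h1 : κ * 2 ≤ κ ^ 3 := by nlinarith [mul_le_mul hκ1 hκ1 zero_le_one hκ0.le]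
    have : (s : ℝ) ≤ r := by linarith
    exact_mod_cast this
  have hD2 : ∑ x ∈ indexSquare k, ((s : ℝ) / r) ^ 2 ≤ 12 * (Real.log k / κ) := by
    refine (const_sum_sq_le hr hn hsr).trans ?_
    have h1 : (s : ℝ) ^ 2 / (k : ℝ) ^ 2 ≤ κ ^ 2 / κ ^ 3 := by rw [hκ]; gcongr
    have h2 : κ ^ 2 / κ ^ 3 = 1 / κ := by field_simp
    have h3 : 0 < 1 / κ := by positivity
    linarith
  obtain ⟨ε, h1, h2⟩ := exists_error_of_poisson_regime (indexSquare k) _ _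
    (fun x _ => mul_nonneg (inv_pos.2 (pairWeight_pos x)).le hu0.le)
    (fun _ _ => by positivity) hs hmean (const_mean hr hn) hD1 hD2 (by linarith)
  exact ⟨ε, by linarith, h2⟩

theorem small_degree_comparison {k r s : ℕ} {κ u : ℝ} (hκ1 : 518400 ≤ κ)
    (hκ : κ ^ 3 = (k : ℝ) ^ 2) (hr : 0 < r) (hs : 0 < s) (hn : k ^ 2 = r + s)
    (hu : IsSaddle k r u) (hrκ : (r : ℝ) ≤ κ) :
    ∃ ε : ℝ, |ε| ≤ 96 / κ ∧
      normalizedCoeff (indexSquare k) (fun x => (pairWeight x)⁻¹ * u) s =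
        normalizedCoeff (indexSquare k) (fun _ => (s : ℝ) / r) s * (1 + ε) := by
  have hκ0 : 0 < κ := by linarith
  have hu0 := hu.1
  have hn' : (k : ℝ) ^ 2 = r + s := by exact_mod_cast hn
  have hr' : (0 : ℝ) < r := by exact_mod_cast hr
  have hs' : (0 : ℝ) < s := by exact_mod_cast hs
  have hκ2 : κ * 4 ≤ κ ^ 3 := by nlinarith [mul_pos hκ0 hκ0]
  have hcard : (indexSquare k).card - s = r := by rw [card_indexSquare]; omega
  have hsc : s ≤ (indexSquare k).card := by rw [card_indexSquare]; omega
  -- For small r the odds u/m are large, so their inverses m/u, with mean r, are used instead.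
  rw [normalizedCoeff_inv _ _ (fun x _ => mul_pos (inv_pos.2 (pairWeight_pos x)) hu0) hsc,
    normalizedCoeff_inv _ (fun _ => (s : ℝ) / r) (fun x _ => by positivity) hsc, hcard]
  simp only [mul_inv, inv_inv, inv_div]
  have hmean := inv_saddle_mean hu
  have hT := sum_pairWeight_sq_le k
  have hsmall : (r : ℝ) * ∑ x ∈ indexSquare k, pairWeight x ^ 2 ≤
      (∑ x ∈ indexSquare k, pairWeight x) ^ 2 / 2 := by
    rw [sum_pairWeight]
    calc (r : ℝ) * ∑ x ∈ indexSquare k, pairWeight x ^ 2 ≤ r * (2 * (k : ℝ) ^ 4) := by gcongr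
      _ = (r * 4) * (k : ℝ) ^ 4 / 2 := by ring
      _ ≤ (k : ℝ) ^ 2 * (k : ℝ) ^ 4 / 2 := by gcongr; linarith
      _ = _ := by ring
  have hD := sum_sq_mul_le_of_mean (indexSquare k) pairWeight (fun x _ => pairWeight_pos x)
    (inv_pos.2 hu0).le hmean hsmall
  have hrk : (r : ℝ) ^ 2 / (k : ℝ) ^ 2 ≤ 1 / κ := by
    have h1 : (r : ℝ) ^ 2 / (k : ℝ) ^ 2 ≤ κ ^ 2 / κ ^ 3 := by rw [hκ]; gcongr
    have h2 : κ ^ 2 / κ ^ 3 = 1 / κ := by field_simp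
    linarith
  have hk' : (k : ℝ) ≠ 0 := fun h => by rw [h] at hn'; norm_num at hn'; linarith
  have hD1 : ∑ x ∈ indexSquare k, (pairWeight x * u⁻¹) ^ 2 ≤ 8 / κ := by
    refine hD.trans ?_
    rw [sum_pairWeight]
    calc _ ≤ 4 * ((r : ℝ) ^ 2 * (2 * (k : ℝ) ^ 4) / ((k : ℝ) ^ 3) ^ 2) := by gcongr
      _ = 8 * ((r : ℝ) ^ 2 / (k : ℝ) ^ 2) := by field_simp; ring
      _ ≤ 8 * (1 / κ) := by gcongr
      _ = _ := by ring
  have hrs : r ≤ s := by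
    have : (r : ℝ) ≤ s := by linarith
    exact_mod_cast this
  have hD2 : ∑ x ∈ indexSquare k, ((r : ℝ) / s) ^ 2 ≤ 8 / κ := by
    refine (const_sum_sq_le hs (by rw [hn, add_comm]) hrs).trans ?_
    have h3 : 0 < 1 / κ := by positivity
    have h4 : 8 / κ = 8 * (1 / κ) := by ring
    linarith
  obtain ⟨ε, h1, h2⟩ := exists_error_of_poisson_regime (indexSquare k) _ _
    (fun x _ => mul_nonneg (pairWeight_pos x).le (inv_pos.2 hu0).le)
    (fun _ _ => by positivity) hr hmean (const_mean hs (by rw [hn, add_comm])) hD1 hD2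
    (by rw [div_le_div_iff₀ hκ0 (by norm_num)]; linarith)
  exact ⟨ε, h1.trans_eq (by ring), h2⟩

theorem bulk_comparison {k r s : ℕ} {κ u : ℝ} (hκ1 : 518400 ≤ κ) (hn : k ^ 2 = r + s)
    (hu : IsSaddle k r u) (hrκ : κ ≤ r) (hsκ : κ ≤ s) :
    ∃ ε : ℝ, |ε| ≤ 1036800 / κ ∧
      normalizedCoeff (indexSquare k) (fun x => (pairWeight x)⁻¹ * u) s =
        normalizedCoeff (indexSquare k) (fun _ => (s : ℝ) / r) s * (1 + ε) := by
  have hκ0 : 0 < κ := by linarith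
  have hu0 := hu.1
  have hn' : (k : ℝ) ^ 2 = r + s := by exact_mod_cast hn
  have hr' : (0 : ℝ) < r := by linarith
  have hs' : (0 : ℝ) < s := by linarith
  have hr : 0 < r := by exact_mod_cast hr'
  have hk0 : 0 < k := Nat.pos_of_ne_zero fun h => by rw [h] at hn; omega
  have hmean : ∑ x ∈ indexSquare k, (pairWeight x)⁻¹ * u / (1 + (pairWeight x)⁻¹ * u) = s := by
    rw [← saddleLHS_eq_mean k hu0, hu.2, hn']
    ring
  have hU := min_le_saddleU hk0 hu
  rw [saddleU_eq_variance k hu0] at hU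
  have hmin : κ ≤ min (r : ℝ) ((k : ℝ) ^ 2 - r) := le_min hrκ (by linarith)
  have hV2 : κ / 72 ≤ (r : ℝ) * s / (r + s) := by
    rw [le_div_iff₀ (by linarith)]
    nlinarith [mul_le_mul_of_nonneg_right hrκ hs'.le, mul_le_mul_of_nonneg_right hsκ hr'.le]
  obtain ⟨ε, h1, h2⟩ := exists_error_of_large_variance (indexSquare k) _ _
    (fun x _ => mul_nonneg (inv_pos.2 (pairWeight_pos x)).le hu0.le)
    (fun _ _ => by positivity) hmean (const_mean hr hn) (V := κ / 72) (by linarith)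
    (by linarith) (by rw [const_variance hr hn]; exact hV2)
  exact ⟨ε, h1.trans_eq (by field_simp; norm_num), h2⟩

theorem uniform_asymptotic {k r : ℕ} {u : ℝ} (hL : 1 ≤ Real.log k)
    (hη : Real.log k / (k : ℝ) ^ (2 / 3 : ℝ) ≤ 1 / 518400) (hr : 0 < r) (hrk : r < k ^ 2)
    (hu : IsSaddle k r u) :
    ∃ ε : ℝ, |ε| ≤ 1036800 * (Real.log k / (k : ℝ) ^ (2 / 3 : ℝ)) ∧
      momentCoeff k r = uniformMain k r u * (1 + ε) := by
  have hk0 : 0 < k := Nat.pos_of_ne_zero fun h => by norm_num [h] at hL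
  have hk' : (0 : ℝ) < k := by exact_mod_cast hk0
  set κ : ℝ := (k : ℝ) ^ (2 / 3 : ℝ) with hκdef
  have hκ0 : 0 < κ := by positivity
  have hκ : κ ^ 3 = (k : ℝ) ^ 2 := by
    rw [hκdef, ← Real.rpow_natCast, ← Real.rpow_mul hk'.le, ← Real.rpow_natCast]
    norm_num
  have hκη : 1 / κ ≤ Real.log k / κ := by gcongr
  have hκ1 : 518400 ≤ κ := by
    have := hκη.trans hη
    rwa [div_le_div_iff₀ hκ0 (by norm_num), one_mul, one_mul] at this
  obtain ⟨s, hs⟩ : ∃ s, k ^ 2 - r = s := ⟨_, rfl⟩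
  have hn : k ^ 2 = r + s := by omega
  have hs0 : 0 < s := by omega
  have key : ∃ ε : ℝ, |ε| ≤ 1036800 * (Real.log k / κ) ∧
      normalizedCoeff (indexSquare k) (fun x => (pairWeight x)⁻¹ * u) s =
        normalizedCoeff (indexSquare k) (fun _ => (s : ℝ) / r) s * (1 + ε) := by
    have h0 : 0 < 1 / κ := by positivity
    rcases le_total (s : ℝ) κ with h | hsκ
    · obtain ⟨ε, h1, h2⟩ :=
        small_codegree_comparison hL (by linarith) hκ hη hr hs0 hn hu h
      exact ⟨ε, by linarith, h2⟩
    rcases le_total (r : ℝ) κ with h | hrκ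
    · obtain ⟨ε, h1, h2⟩ := small_degree_comparison hκ1 hκ hr hs0 hn hu h
      rw [div_eq_mul_one_div] at h1
      exact ⟨ε, by linarith, h2⟩
    · obtain ⟨ε, h1, h2⟩ := bulk_comparison hκ1 hn hu hrκ hsκ
      rw [div_eq_mul_one_div] at h1
      exact ⟨ε, by linarith, h2⟩
  obtain ⟨ε, h1, h2⟩ := key
  refine ⟨ε, h1, ?_⟩
  have hu0 := hu.1
  have hP : 0 < (momentPoly k).eval u := by
    rw [momentPoly_eq_linProd, linProd_eval]
    refine Finset.prod_pos fun x _ => ?_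
    have := pairWeight_pos x
    positivity
  have hU : 0 < √(saddleU k u) := by
    refine Real.sqrt_pos.2 ?_
    rw [saddleU_eq_sum]
    refine Finset.sum_pos (fun x _ => ?_) ⟨(0, 0), by simp [indexSquare, hk0]⟩
    have := pairWeight_pos x
    positivity
  rw [uniformMain_eq hr hrk, hs]
  have h3 := normalizedCoeff_saddle (k := k) (r := r) hu0
  rw [hs, h2] at h3
  have h4 : momentCoeff k r = momentCoeff k r * u ^ s * √(saddleU k u) / (momentPoly k).eval u *
      ((momentPoly k).eval u / (√(saddleU k u) * u ^ s)) := by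
    field_simp
  rw [h4, ← h3]
  ring

/-- The bound 1/518400 forces κ ≥ 518400 = 72 · 7200, so that the variance bound κ/72 of the middle
range reaches 7200. -/
theorem eventually_log_large :
    ∃ K : ℕ, ∀ k : ℕ, K ≤ k → 1 ≤ Real.log k ∧
      Real.log k / (k : ℝ) ^ (2 / 3 : ℝ) ≤ 1 / 518400 := by
  have h1 : Filter.Tendsto (fun k : ℕ => Real.log k) Filter.atTop Filter.atTop :=
    Real.tendsto_log_atTop.comp tendsto_natCast_atTop_atTop
  have h2 : Filter.Tendsto (fun k : ℕ => Real.log k / (k : ℝ) ^ (2 / 3 : ℝ)) Filter.atTop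
      (nhds 0) :=
    (isLittleO_log_rpow_atTop (by norm_num : (0 : ℝ) < 2 / 3)).tendsto_div_nhds_zero.comp
      tendsto_natCast_atTop_atTop
  have h3 := (h1.eventually_ge_atTop 1).and
    (h2.eventually_le_const (show (0 : ℝ) < 1 / 518400 by norm_num))
  exact Filter.eventually_atTop.1 h3

end UniformAsymptotics

/-! ### The main theorem -/

theorem theorem1 :
    -- the saddle point exists and is unique
    (∀ k r : ℕ, 0 < r → r < k ^ 2 → ∃! u : ℝ, IsSaddle k r u) ∧
    -- the uniform asymptotic formula
    (∃ (M : ℝ) (K : ℕ), ∀ k : ℕ, K ≤ k → ∀ r : ℕ, 0 < r → r < k ^ 2 →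
      ∀ u : ℝ, IsSaddle k r u →
        ∃ ε : ℝ, |ε| ≤ M * (Real.log k / (k : ℝ) ^ (2 / 3 : ℝ)) ∧
          momentCoeff k r = uniformMain k r u * (1 + ε)) ∧
    -- the leading coefficients
    (∀ α : ℝ, α < 1 → ∃ (M : ℝ) (K : ℕ), ∀ k : ℕ, K ≤ k → ∀ r : ℕ, (r : ℝ) ≤ (k : ℝ) ^ α →
      (∃ ε : ℝ, |ε| ≤ M * (k : ℝ) ^ (2 * (α - 1)) ∧
        momentCoeff k r / momentCoeff k 0 =
          (k : ℝ) ^ (3 * r) / (r.factorial : ℝ) * (1 + ε)) ∧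
      (∃ ε : ℝ, |ε| ≤ M * (k : ℝ) ^ (2 * (α - 1)) ∧
        momentCoeff k r / momentCoeff k 0 =
          ((k ^ 2).choose r : ℝ) * (k : ℝ) ^ r * (1 + ε))) ∧
    -- the trailing coefficients
    (∀ α : ℝ, α < 1 → ∃ (M : ℝ) (K : ℕ), ∀ k : ℕ, K ≤ k → ∀ r : ℕ, (r : ℝ) ≤ (k : ℝ) ^ α →
      (∃ ε : ℝ, |ε| ≤ M * ((k : ℝ) ^ (2 * (α - 1)) * Real.log k) ∧
        momentCoeff k (k ^ 2 - r) =
          ((k : ℝ) * harmonicA k) ^ r / (r.factorial : ℝ) * (1 + ε)) ∧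
      (∃ ε : ℝ, |ε| ≤ M * ((k : ℝ) ^ (2 * (α - 1)) * Real.log k) ∧
        momentCoeff k (k ^ 2 - r) =
          ((k ^ 2).choose r : ℝ) * (harmonicA k ^ r / (k : ℝ) ^ r) * (1 + ε))) ∧
    -- the expansion of `A`
    (∃ (M : ℝ) (K : ℕ), ∀ k : ℕ, K ≤ k →
      |harmonicA k - (Real.log 4 - 1 / (2 * (k : ℝ)))| ≤ M / (k : ℝ) ^ 2) := by
  refine ⟨fun k r hr hrk => existsUnique_isSaddle hr hrk, ?_, ?_, ?_,
    1, 1, fun k hk => abs_harmonicA_sub_le hk⟩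
  · obtain ⟨K, hK⟩ := eventually_log_large
    exact ⟨1036800, K, fun k hk r hr hrk u hu =>
      uniform_asymptotic (hK k hk).1 (hK k hk).2 hr hrk hu⟩
  · intro α hα
    refine ⟨3, 1, fun k hk r hr => ?_⟩
    obtain ⟨hrk, hle⟩ := sq_div_sq_le_rpow hk hα hr
    obtain ⟨⟨ε₁, h1, h2⟩, ε₂, h3, h4⟩ := leading_coefficients hk hrk
    exact ⟨⟨ε₁, by linarith, h2⟩, ε₂, by linarith, h4⟩
  · intro α hα
    obtain ⟨K, hK⟩ := eventually_log_large
    refine ⟨4, K, fun k hk r hr => ?_⟩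
    have hL := (hK k hk).1
    have hk0 : 0 < k := Nat.pos_of_ne_zero fun h => by norm_num [h] at hL
    obtain ⟨hrk, hle⟩ := sq_div_sq_le_rpow hk0 hα hr
    have hle' := mul_le_mul_of_nonneg_right hle (zero_le_one.trans hL)
    obtain ⟨⟨ε₁, h1, h2⟩, ε₂, h3, h4⟩ := trailing_coefficients hL hrk
    exact ⟨⟨ε₁, by linarith, h2⟩, ε₂, by linarith, h4⟩
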